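/- Let $M$ be a smooth (Hausdorff, finite-dimensional, boundaryless) manifold with a semi-Riemannian metric $\mathbf g=\langle\cdot,\cdot\rangle$ and Levi-Civita connection $\nabla$, and let $\mathbf A$ be a smooth vector field on $M$. Consider the affine metric $(X,Y)=1+\langle X-\mathbf A,Y-\mathbf A\rangle$, and let $\widehat{TM}$ be the bundle whose fibre at $p$ is the space of real affine functions on $T_pM$. For $x\in T_pM$ let $\bar x$ be the affine function $y\mapsto\langle x,y-\mathbf A_p\rangle$, and let $\xi$ be the constant function $1$; every smooth section of $\widehat{TM}$ is uniquely $\bar X+f\xi$ with $X$ a smooth vector field and $f$ a smooth function. Let $F$ be the anti-symmetric part of $\nabla\mathbf A$, $\langle F(X),Y\rangle=\tfrac12(\langle\nabla_X\mathbf A,Y\rangle-\langle X,\nabla_Y\mathbf A\rangle)$. Equip $\widehat{TM}$ with the metric $\hat{\mathbf g}$, $\langle\bar X+f\xi,\bar Y+h\xi\rangle=\langle X,Y\rangle+fh$, the anchor $\rho(\bar X+f\xi)=X$, and the bracket determined by the Leibniz rule and $[\bar X,\bar Y]=\overline{[X,Y]}+2\langle F(X),Y\rangle\xi$, $[\bar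 X,\xi]=0$. Let $\hat\nabla$ be its Levi-Civita connection, given by the Koszul formula $$2\langle\hat\nabla_UV,W\rangle=\rho(U)\langle V,W\rangle+\rho(V)\langle W,U\rangle-\rho(W)\langle U,V\rangle+\langle[U,V],W\rangle-\langle[V,W],U\rangle+\langle[W,U],V\rangle .$$ For both $\nabla$ and $\hat\nabla$ let the curvature be $R(U,V)W=\nabla_U\nabla_VW-\nabla_V\nabla_UW-\nabla_{[U,V]}W$, let the Ricci tensor be the $(1,1)$ tensor $\mathrm{Ric}(U)=\sum_i\epsilon_iR(U,E_i)E_i$ for an orthonormal basis $E_i$ with $\epsilon_i=\langle E_i,E_i\rangle=\pm1$, and let the scalar curvature be the trace of the Ricci tensor; hats denote the objects of $\widehat{TM}$. Let $\mathrm{div}F=\sum_i\epsilon_i(\nabla_{E_i}F)(E_i)$. Then, at every point and for all tangent vectors $X,Y$: 1. $\widehat{\mathrm{Ric}}(\xi)=\overline{\mathrm{div}F}-\mathrm{tr}(F\circ F)\,\xi$. 2. $\widehat{\mathrm{Ric}}(\bar X)=\overline{\mathrm{Ric}(X)}+2\,\overline{F(F(X))}+\langle\mathrm{div}F,X\rangle\,\xi$.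 3. $\hat R=R+\mathrm{tr}(F\circ F)$, where $\hat R$ and $R$ are here the scalar curvatures. 4. The tensor $\hat G=\widehat{\mathrm{Ric}}-\tfrac12\hat R\,\hat{\mathbf g}$, as a bilinear form $\hat G(u,v)=\langle\widehat{\mathrm{Ric}}(u),v\rangle-\tfrac12\hat R\langle u,v\rangle$, satisfies $$\hat G(\bar X,\bar Y)=\langle\mathrm{Ric}(X)+2F(F(X)),Y\rangle-\tfrac12\big(R+\mathrm{tr}(F\circ F)\big)\langle X,Y\rangle,$$ $$\hat G(\bar X,\xi)=\hat G(\xi,\bar X)=\langle\mathrm{div}F,X\rangle,\qquad \hat G(\xi,\xi)=-\tfrac12\big(R+3\,\mathrm{tr}(F\circ F)\big).$$ Moreover $\hat G(\bar X,\bar Y)=G(X,Y)-8\pi T^{elec}(X,Y)$, where $G(X,Y)=\langle\mathrm{Ric}(X),Y\rangle-\tfrac12R\langle X,Y\rangle$ is the Einstein tensor of $\mathbf g$ and $T^{elec}(X,Y)=-\tfrac1{4\pi}\big(\langle F(F(X)),Y\rangle-\tfrac14\mathrm{tr}(F\circ F)\langle X,Y\rangle\big)$ is the electromagnetic stress tensor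 of the field $2F$. In particular this holds on a Lorentzian $4$-manifold. -/

import Mathlib

open scoped Manifold ContDiff

noncomputable section

set_option linter.unusedSectionVars false

namespace AffineAlgebroid

/-! ## Semi-Riemannian algebroids: connection, curvature, Ricci and scalar curvature -/

section Algebroid

variable {E : Type*} [NormedAddCommGroup E] [NormedSpace ℝ E] [FiniteDimensional ℝ E]
  {H : Type*} [TopologicalSpace H] {I : ModelWithCorners ℝ E H}
  {M : Type*} [TopologicalSpace M] [ChartedSpace H M]
  {V : M → Type*} [∀ p, AddCommGroup (V p)] [∀ p, Module ℝ (V p)]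

variable (I V) in
/-- The operations of a semi-Riemannian algebroid with fibres `V p` over `M`: which sections are
smooth, the anchor, the bracket of sections and the fibre metric.  It is only a record: it is used
for the two concrete algebroids `tangentAlgebroid` and `hatAlgebroid` below, in order to define
Levi-Civita connection, curvature, Ricci tensor and scalar curvature once for both of them. -/
structure SRAlgebroid where
  IsSmooth : (Π p, V p) → Prop
  anchor : Π p, V p →ₗ[ℝ] TangentSpace I p
  bracket : (Π p, V p) → (Π p, V p) → (Π p, V p)
  metric : Π p, LinearMap.BilinForm ℝ (V p)
  nondegenerate : ∀ p, (metric p).Nondegenerate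

variable (𝔞 : SRAlgebroid I V)

/-- The function `q ↦ ⟨S_q, T_q⟩`. -/
def SRAlgebroid.pairing (S T : Π p, V p) : M → ℝ := fun q ↦ 𝔞.metric q (S q) (T q)

/-- The derivative `ρ(U) f` at `p` of a function `f` along the section `U`. -/
def SRAlgebroid.deriv (U : Π p, V p) (f : M → ℝ) (p : M) : ℝ :=
  mvfderiv I f p (𝔞.anchor p (U p))

/-- The right-hand side of the Koszul formula for `2 ⟨∇_U S, W⟩`. -/
def SRAlgebroid.koszul (U S W : Π p, V p) (p : M) : ℝ :=
  𝔞.deriv U (𝔞.pairing S W) p + 𝔞.deriv S (𝔞.pairing W U) p - 𝔞.deriv W (𝔞.pairing U S) p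
    + 𝔞.pairing (𝔞.bracket U S) W p - 𝔞.pairing (𝔞.bracket S W) U p
    + 𝔞.pairing (𝔞.bracket W U) S p

/-- The Levi-Civita connection: `∇_U S` at `p` is the (unique) vector satisfying the Koszul formula
against every smooth section `W`. -/
def SRAlgebroid.conn (U S : Π p, V p) (p : M) : V p :=
  Classical.epsilon fun v : V p ↦
    ∀ W : Π p, V p, 𝔞.IsSmooth W → 2 * 𝔞.metric p v (W p) = 𝔞.koszul U S W p

/-- `R(U, V) W = ∇_U ∇_V W - ∇_V ∇_U W - ∇_{[U, V]} W` on sections. -/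
def SRAlgebroid.curvatureOp (U S W : Π p, V p) : Π p, V p :=
  𝔞.conn U (𝔞.conn S W) - 𝔞.conn S (𝔞.conn U W) - 𝔞.conn (𝔞.bracket U S) W

/-- The curvature tensor at `p`: the (unique) trilinear map inducing `curvatureOp` on smooth
sections. -/
def SRAlgebroid.curvature (p : M) : V p →ₗ[ℝ] V p →ₗ[ℝ] V p →ₗ[ℝ] V p :=
  Classical.epsilon fun R : V p →ₗ[ℝ] V p →ₗ[ℝ] V p →ₗ[ℝ] V p ↦
    ∀ U S W : Π p, V p, 𝔞.IsSmooth U → 𝔞.IsSmooth S → 𝔞.IsSmooth W →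
      R (U p) (S p) (W p) = 𝔞.curvatureOp U S W p

/-- Metric contraction `∑ i, B(e_i, e^i)` of a bilinear map, with `e_i` a basis of `V p` and `e^i`
the dual basis with respect to the metric; it does not depend on the basis, and for an orthonormal
basis `X_i` with `ε_i = ⟨X_i, X_i⟩ = ± 1` it is `∑ i, ε_i B(X_i, X_i)`. -/
def SRAlgebroid.contract [∀ p, FiniteDimensional ℝ (V p)] {W : Type*} [AddCommGroup W] [Module ℝ W]
    (p : M) (B : V p →ₗ[ℝ] V p →ₗ[ℝ] W) : W :=
  ∑ i, B (Module.finBasis ℝ (V p) i)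
    ((𝔞.metric p).dualBasis (𝔞.nondegenerate p) (Module.finBasis ℝ (V p)) i)

/-- For fixed `u`, the bilinear map `(v, w) ↦ R(u, v) w` is contracted; this is the Ricci tensor as
a `(1,1)` tensor, `Ric(u) = ∑ i, ε_i R(u, X_i) X_i`. -/
def SRAlgebroid.ricci [∀ p, FiniteDimensional ℝ (V p)] (p : M) : V p →ₗ[ℝ] V p where
  toFun u := 𝔞.contract p (𝔞.curvature p u)
  map_add' u v := by simp [SRAlgebroid.contract, Finset.sum_add_distrib]
  map_smul' c u := by simp [SRAlgebroid.contract, Finset.smul_sum]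

/-- Scalar curvature: the trace of the Ricci tensor. -/
def SRAlgebroid.scalar [∀ p, FiniteDimensional ℝ (V p)] (p : M) : ℝ :=
  LinearMap.trace ℝ (V p) (𝔞.ricci p)

/-- The Einstein tensor `Ric - (1/2) R g` as a bilinear form. -/
def SRAlgebroid.einstein [∀ p, FiniteDimensional ℝ (V p)] (p : M) (u v : V p) : ℝ :=
  𝔞.metric p (𝔞.ricci p u) v - 1 / 2 * 𝔞.scalar p * 𝔞.metric p u v

end Algebroid

/-! ## Semi-Riemannian manifolds -/

variable {E : Type*} [NormedAddCommGroup E] [NormedSpace ℝ E] [FiniteDimensional ℝ E]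
  {H : Type*} [TopologicalSpace H] {I : ModelWithCorners ℝ E H}
  {M : Type*} [TopologicalSpace M] [ChartedSpace H M]

instance (p : M) : FiniteDimensional ℝ (TangentSpace I p) :=
  inferInstanceAs (FiniteDimensional ℝ E)

variable (I) in
/-- Smooth vector fields. -/
def IsSmoothField [IsManifold I ∞ M] (X : Π p : M, TangentSpace I p) : Prop :=
  ContMDiff I I.tangent ∞ (fun p ↦ (⟨p, X p⟩ : TangentBundle I M))

variable (I M) in
/-- A smooth semi-Riemannian metric (of arbitrary signature). -/
structure SemiRiemannianMetric [IsManifold I ∞ M] where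
  inner (p : M) : TangentSpace I p →L[ℝ] TangentSpace I p →L[ℝ] ℝ
  symm (p : M) (v w : TangentSpace I p) : inner p v w = inner p w v
  nondegenerate (p : M) (v : TangentSpace I p) (hv : ∀ w, inner p v w = 0) : v = 0
  contMDiff : ContMDiff I (I.prod 𝓘(ℝ, E →L[ℝ] E →L[ℝ] ℝ)) ∞
    (fun p ↦ Bundle.TotalSpace.mk' (E →L[ℝ] E →L[ℝ] ℝ) p (inner p))

variable [IsManifold I ∞ M] (g : SemiRiemannianMetric I M)

/-- The metric at `p` as a bilinear form. -/
def SemiRiemannianMetric.form (p : M) : LinearMap.BilinForm ℝ (TangentSpace I p) :=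
  LinearMap.mk₂ ℝ (fun v w ↦ g.inner p v w) (by simp) (by simp) (by simp) (by simp)

theorem SemiRiemannianMetric.form_apply (p : M) (v w : TangentSpace I p) :
    g.form p v w = g.inner p v w := rfl

theorem SemiRiemannianMetric.form_nondegenerate (p : M) : (g.form p).Nondegenerate :=
  ⟨fun v hv ↦ g.nondegenerate p v hv,
    fun v hv ↦ g.nondegenerate p v fun w ↦ by rw [g.symm]; exact hv w⟩

/-- The tangent bundle as a semi-Riemannian algebroid: identity anchor and Lie bracket of vector
fields.  Its connection, curvature, Ricci tensor, scalar curvature and Einstein tensor are the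
usual ones of `(M, g)`. -/
def tangentAlgebroid : SRAlgebroid I (fun p : M ↦ TangentSpace I p) where
  IsSmooth := IsSmoothField I
  anchor _ := LinearMap.id
  bracket X Y := VectorField.mlieBracket I X Y
  metric := g.form
  nondegenerate := g.form_nondegenerate

/-! ## The tensor `F`, its divergence, and the electromagnetic stress tensor -/

section Tensor

variable (A : Π p : M, TangentSpace I p)

/-- The anti-symmetric part `F` of `∇A`: the (unique) endomorphism of `T_pM` with
`⟨F X, Y⟩ = (1/2) (⟨∇_X A, Y⟩ - ⟨X, ∇_Y A⟩)` for smooth vector fields `X`, `Y`. -/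
def fieldF (p : M) : TangentSpace I p →ₗ[ℝ] TangentSpace I p :=
  Classical.epsilon fun f : TangentSpace I p →ₗ[ℝ] TangentSpace I p ↦
    ∀ X Y : Π p : M, TangentSpace I p, IsSmoothField I X → IsSmoothField I Y →
      g.inner p (f (X p)) (Y p) = 1 / 2 *
        (g.inner p ((tangentAlgebroid g).conn X A p) (Y p)
          - g.inner p (X p) ((tangentAlgebroid g).conn Y A p))

/-- The covariant derivative `∇T` of a field `T` of endomorphisms, at `p`: the (unique) bilinear
map `(X, Y) ↦ (∇_X T)(Y) = ∇_X (T Y) - T (∇_X Y)`. -/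
def covDeriv (T : Π p : M, TangentSpace I p →ₗ[ℝ] TangentSpace I p) (p : M) :
    TangentSpace I p →ₗ[ℝ] TangentSpace I p →ₗ[ℝ] TangentSpace I p :=
  Classical.epsilon fun D : TangentSpace I p →ₗ[ℝ] TangentSpace I p →ₗ[ℝ] TangentSpace I p ↦
    ∀ X Y : Π p : M, TangentSpace I p, IsSmoothField I X → IsSmoothField I Y →
      D (X p) (Y p) = (tangentAlgebroid g).conn X (fun q ↦ T q (Y q)) p
        - T p ((tangentAlgebroid g).conn X Y p)

/-- The vector `div T = ∑ i, ε_i (∇_{X_i} T)(X_i)`. -/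
def divergence (T : Π p : M, TangentSpace I p →ₗ[ℝ] TangentSpace I p) (p : M) :
    TangentSpace I p :=
  (tangentAlgebroid g).contract p (covDeriv g T p)

/-- `tr(F ∘ F)`. -/
def traceFF (p : M) : ℝ :=
  LinearMap.trace ℝ (TangentSpace I p) (fieldF g A p ∘ₗ fieldF g A p)

/-- The stress tensor of the electromagnetic field with electromagnetic tensor `2F`, in units with
`c = G = 1` and `ε₀ = 1/(16π)`: `T = -1/(4π) (F ∘ F - (1/4) tr(F ∘ F) g)`. -/
def stressElec (p : M) (x y : TangentSpace I p) : ℝ :=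
  -1 / (4 * Real.pi) *
    (g.inner p (fieldF g A p (fieldF g A p x)) y - 1 / 4 * traceFF g A p * g.inner p x y)

end Tensor

/-! ## The algebroid of affine functions on the tangent spaces -/

section Hat

variable (I) in
/-- The fibre at `p`: real valued affine functions on `T_pM`. -/
abbrev Hat (p : M) : Type _ := TangentSpace I p →ᵃ[ℝ] ℝ

instance (p : M) : FiniteDimensional ℝ (Hat I p) :=
  Module.Finite.equiv (AffineMap.toConstProdLinearMap (R := ℝ) (k := ℝ) (V1 := TangentSpace I p)
    (V2 := ℝ)).symm

variable (A : Π p : M, TangentSpace I p)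

/-- The affine metric `(x, y) = 1 + ⟨x - A, y - A⟩`. -/
def affineMetric (p : M) (x y : TangentSpace I p) : ℝ := 1 + g.inner p (x - A p) (y - A p)

/-- The affine function `x̄ : y ↦ ⟨x, y - A⟩`, i.e. the part of `(x, y)` that is linear in `x` and
affine in `y`, see `affineMetric_add_left`. -/
def bar (p : M) : TangentSpace I p →ₗ[ℝ] Hat I p where
  toFun x := (g.form p x).toAffineMap - AffineMap.const ℝ _ (g.form p x (A p))
  map_add' x y := by ext z; simp; ring
  map_smul' c x := by ext z; simp; ring

/-- The constant affine function `1`. -/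
def xi (p : M) : Hat I p := AffineMap.const ℝ _ 1

theorem bar_apply (p : M) (x y : TangentSpace I p) :
    bar g A p x y = g.inner p x (y - A p) := by
  simp [bar, SemiRiemannianMetric.form]

theorem affineMetric_add_left (p : M) (a x y : TangentSpace I p) :
    affineMetric g A p (a + x) y = affineMetric g A p a y + bar g A p x y := by
  rw [bar_apply, affineMetric, affineMetric, add_sub_right_comm, map_add]
  simp [add_assoc]

/-- The projection (anchor) `ρ : x̄ + c ξ ↦ x`. -/
def rho (p : M) : Hat I p →ₗ[ℝ] TangentSpace I p where
  toFun s := ((g.form p).toDual (g.form_nondegenerate p)).symm s.linear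
  map_add' s t := by
    rw [← map_add]; rfl
  map_smul' c s := by
    rw [← map_smul]; rfl

/-- Every element of the fibre is `x̄ + c ξ` with `x = ρ(s)` and `c = s(A)`. -/
theorem bar_rho_add (p : M) (s : Hat I p) :
    bar g A p (rho g p s) + s (A p) • (xi p : Hat I p) = s := by
  ext y
  have h : ∀ z, g.form p (rho g p s) z = s.linear z := fun z ↦ by
    simp [rho]
  have h2 := s.linearMap_vsub y (A p)
  have h3 : bar g A p (rho g p s) y = s.linear (y - A p) := by
    rw [← h]; exact bar_apply ..
  simp only [AffineMap.coe_add, AffineMap.coe_smul, Pi.add_apply, Pi.smul_apply, h3, xi]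
  simp only [vsub_eq_sub] at h2
  simp [h2]

theorem rho_bar (p : M) (x : TangentSpace I p) : rho g p (bar g A p x) = x := by
  have : (bar g A p x).linear = g.form p x := by
    ext z
    simp [bar]
  simp only [rho, LinearMap.coe_mk, AddHom.coe_mk, this]
  exact LinearEquiv.symm_apply_apply ((g.form p).toDual (g.form_nondegenerate p)) x

theorem bar_apply_A (p : M) (x : TangentSpace I p) : bar g A p x (A p) = 0 := by
  rw [bar_apply, sub_self, map_zero]

/-- The induced metric `⟨x̄ + c ξ, ȳ + d ξ⟩ = ⟨x, y⟩ + c d`. -/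
def hatForm (p : M) : LinearMap.BilinForm ℝ (Hat I p) :=
  LinearMap.mk₂ ℝ (fun s t ↦ g.form p (rho g p s) (rho g p t) + s (A p) * t (A p))
    (by intros; simp; ring) (by intros; simp; ring) (by intros; simp; ring) (by intros; simp; ring)

theorem hatForm_apply (p : M) (s t : Hat I p) :
    hatForm g A p s t = g.inner p (rho g p s) (rho g p t) + s (A p) * t (A p) := rfl

theorem hatForm_nondegenerate (p : M) : (hatForm g A p).Nondegenerate := by
  have key : ∀ s : Hat I p, (∀ t, hatForm g A p s t = 0) → s = 0 := by
    intro s hs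
    have h1 : rho g p s = 0 := g.nondegenerate p _ fun w ↦ by
      have := hs (bar g A p w)
      simpa [hatForm, rho_bar, bar_apply_A, SemiRiemannianMetric.form_apply] using this
    have h2 : s (A p) = 0 := by
      have := hs (xi p)
      simpa [hatForm, h1, xi] using this
    rw [← bar_rho_add g A p s, h1, h2]
    simp
  refine ⟨key, fun s hs ↦ key s fun t ↦ ?_⟩
  rw [← hs t]
  simp only [hatForm, LinearMap.mk₂_apply]
  rw [mul_comm]
  congr 1
  exact g.symm _ _ _

/-- The induced metric is the one for which `⟨x̂, ŷ⟩ = (x, y)`, where `x̂ = (x, ·)` is the affine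
function `bar (x - A) + ξ`. -/
theorem hatForm_hat (p : M) (x y : TangentSpace I p) :
    hatForm g A p (bar g A p (x - A p) + xi p) (bar g A p (y - A p) + xi p)
      = affineMetric g A p x y := by
  have h : rho g p (xi p) = 0 := by
    have := rho_bar g A p (rho g p (xi p))
    have h2 : (xi p : Hat I p).linear = 0 := rfl
    simp only [rho, LinearMap.coe_mk, AddHom.coe_mk, h2, map_zero]
  have h3 : (xi p : Hat I p) (A p) = 1 := rfl
  rw [hatForm_apply]
  simp only [map_add, rho_bar, h, add_zero, AffineMap.coe_add,
    Pi.add_apply, bar_apply_A, zero_add, h3, affineMetric]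
  ring

/-- The bracket determined by `[X̄, Ȳ] = bar [X, Y] + 2 ⟨F X, Y⟩ ξ`, `[X̄, ξ] = 0` and the Leibniz
rule: for `S = X̄ + f ξ` and `T = Ȳ + h ξ` it is
`bar [X, Y] + (X(h) - Y(f) + 2 ⟨F X, Y⟩) ξ`. -/
def hatBracket (S T : Π p : M, Hat I p) : Π p : M, Hat I p := fun p ↦
  bar g A p (VectorField.mlieBracket I (fun q ↦ rho g q (S q)) (fun q ↦ rho g q (T q)) p)
    + (mvfderiv I (fun q ↦ T q (A q)) p (rho g p (S p))
      - mvfderiv I (fun q ↦ S q (A q)) p (rho g p (T p))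
      + 2 * g.inner p (fieldF g A p (rho g p (S p))) (rho g p (T p))) • (xi p : Hat I p)

/-- The semi-Riemannian algebroid of affine functions on the tangent spaces of `M`.  Its smooth
sections are the `X̄ + f ξ` with `X` a smooth vector field and `f` a smooth function. -/
def hatAlgebroid : SRAlgebroid I (fun p : M ↦ Hat I p) where
  IsSmooth S := IsSmoothField I (fun q ↦ rho g q (S q)) ∧
    ContMDiff I 𝓘(ℝ) ∞ (fun q ↦ S q (A q))
  anchor := rho g
  bracket := hatBracket g A
  metric := hatForm g A
  nondegenerate := hatForm_nondegenerate g A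

end Hat

end AffineAlgebroid

end

open AffineAlgebroid

/-!
Both algebroids of the statement, `TM` and the bundle of affine functions, satisfy the same short
list of laws, `SRAlgebroid.IsLawful`, and the fundamental theorem of semi-Riemannian geometry holds
for every lawful algebroid.  All the objects of the statement are chosen by `Classical.epsilon` from
the property that characterises them on smooth sections, so each of them comes with an existence
theorem: an operation that is linear over the smooth functions is induced by a linear map of the
fibres (`SRAlgebroid.IsLawful.exists_linearMap`).  Tensoriality is proved with Gram determinants:
if smooth sections `e i` form a basis at `p`, then Cramer's rule writes a section, multiplied by a
smooth function that does not vanish at `p`, as a combination of the `e i` on all of `M`.  The same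
identity shows that a section with smooth products is smooth, whence `∇` and `F` preserve smoothness.

The geometric content is in `conn_hatSection`: the Koszul formula gives
`∇̂_{X̄ + fξ} (Ȳ + hξ) = bar (∇_X Y - h F X - f F Y) + (⟨F X, Y⟩ + X(h)) ξ`.
Inserting this into the definition of the curvature yields
* `R̂(ξ, X̄) Ȳ = bar ((∇_X F) Y) + ⟨F X, F Y⟩ ξ` and `R̂(X̄, ξ) ξ = - bar (F (F X))`,
* `R̂(X̄, Ȳ) Z̄ = bar (R(X, Y) Z - ⟨F Y, Z⟩ F X + ⟨F X, Z⟩ F Y + 2 ⟨F X, Y⟩ F Z)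
  + ⟨(∇_X F) Y - (∇_Y F) X, Z⟩ ξ`.
The Ricci tensor is the contraction of these over `bar e_i` and `ξ`, where `e_i` is a basis of the
tangent space; since `F` and `∇_X F` are skew, `tr F` and `tr (∇_X F)` drop out and `tr (∇F · X)`
becomes `-⟨div F, X⟩`.  The scalar curvature and the Einstein tensor follow by algebra.
-/

noncomputable section

set_option linter.unusedSectionVars false

namespace AffineAlgebroid

/-! ### Gram matrices and metric contractions -/

section LinearAlgebra

variable {V : Type*} [AddCommGroup V] [Module ℝ V] [FiniteDimensional ℝ V]

/-- Cramer's rule for the expansion of a vector in a basis, in terms of its products with the basis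
vectors.  The coefficients are polynomial in the entries of the Gram matrix. -/
theorem det_gram_smul_eq (B : LinearMap.BilinForm ℝ V) {n : ℕ} (hn : n = Module.finrank ℝ V)
    (e : Fin n → V) (h : (Matrix.of fun i j ↦ B (e i) (e j)).det ≠ 0) (v : V) :
    (Matrix.of fun i j ↦ B (e i) (e j)).det • v =
      ∑ i, (∑ j, B v (e j) * (Matrix.of fun i j ↦ B (e i) (e j)).adjugate j i) • e i := by
  set G : Matrix (Fin n) (Fin n) ℝ := Matrix.of fun i j ↦ B (e i) (e j) with hG
  have hB : ∀ (c : Fin n → ℝ) (j), B (∑ i, c i • e i) (e j) = Matrix.vecMul c G j := fun c j ↦ by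
    simp [hG, Matrix.vecMul, dotProduct, LinearMap.sum_apply]
  have hli : LinearIndependent ℝ e := by
    rw [Fintype.linearIndependent_iff]
    intro c hc
    have h0 : Matrix.vecMul c G = 0 := by
      ext j
      rw [← hB, hc]
      simp
    exact congrFun (Matrix.eq_zero_of_vecMul_eq_zero h h0)
  let b := Module.Basis.mk hli (hli.span_eq_top_of_card_eq_finrank' (by simp [hn])).ge
  obtain ⟨c, rfl⟩ : ∃ c : Fin n → ℝ, v = ∑ i, c i • e i :=
    ⟨b.repr v, by conv_lhs => rw [← b.sum_repr v]
                  simp [b]⟩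
  rw [Finset.smul_sum]
  refine Finset.sum_congr rfl fun i _ ↦ ?_
  rw [smul_smul]
  congr 1
  have : Matrix.vecMul (Matrix.vecMul c G) G.adjugate i = G.det * c i := by
    rw [Matrix.vecMul_vecMul, Matrix.mul_adjugate, Matrix.vecMul_smul, Matrix.vecMul_one]
    rfl
  rw [← this]
  simp only [hB]
  rfl

theorem det_gram_basis_ne_zero (B : LinearMap.BilinForm ℝ V) (hB : B.Nondegenerate) {n : ℕ}
    (b : Module.Basis (Fin n) ℝ V) : (Matrix.of fun i j ↦ B (b i) (b j)).det ≠ 0 := by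
  have := (LinearMap.BilinForm.nondegenerate_iff_det_ne_zero (B := B) b).1 hB
  convert this using 2
  ext i j
  simp [LinearMap.BilinForm.toMatrix_apply]

theorem sum_dualBasis_left (B : LinearMap.BilinForm ℝ V) (hB : B.Nondegenerate)
    {ι : Type*} [Fintype ι] [DecidableEq ι] (b : Module.Basis ι ℝ V) (v : V) :
    ∑ i, B v (b i) • B.dualBasis hB b i = v := by
  conv_rhs => rw [← (B.dualBasis hB b).sum_repr v]
  simp

theorem sum_dualBasis_right (B : LinearMap.BilinForm ℝ V) (hB : B.Nondegenerate)
    (hs : ∀ v w, B v w = B w v)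
    {ι : Type*} [Fintype ι] [DecidableEq ι] (b : Module.Basis ι ℝ V) (v : V) :
    ∑ i, B v (B.dualBasis hB b i) • b i = v := by
  have h := sum_dualBasis_left B hB (B.dualBasis hB b) v
  rwa [LinearMap.BilinForm.dualBasis_dualBasis hB ⟨hs⟩] at h

/-- Contractions may be computed with any pair of families `a`, `a'` that represents the identity,
`v = ∑ j, ⟨v, a' j⟩ a j`; no basis is needed. -/
theorem sum_eq_sum_of_represents {W : Type*} [AddCommGroup W] [Module ℝ W]
    (B : LinearMap.BilinForm ℝ V) {ι κ : Type*} [Fintype ι] [Fintype κ] {e e' : ι → V}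
    {a a' : κ → V} (he : ∀ v, ∑ i, B v (e i) • e' i = v) (hs : ∀ v w, B v w = B w v)
    (ha : ∀ v, ∑ j, B v (a' j) • a j = v) (T : V →ₗ[ℝ] V →ₗ[ℝ] W) :
    ∑ i, T (e i) (e' i) = ∑ j, T (a j) (a' j) := by
  calc ∑ i, T (e i) (e' i)
      = ∑ i, ∑ j, T (a j) (B (a' j) (e i) • e' i) := by
        refine Finset.sum_congr rfl fun i _ ↦ ?_
        conv_lhs => rw [← ha (e i)]
        simp [hs (e i)]
    _ = ∑ j, T (a j) (a' j) := by
        rw [Finset.sum_comm]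
        refine Finset.sum_congr rfl fun j _ ↦ ?_
        rw [← map_sum, he]

theorem trace_eq_sum_of_represents (B : LinearMap.BilinForm ℝ V) {κ : Type*} [Fintype κ]
    {a a' : κ → V} (ha : ∀ v, ∑ j, B v (a' j) • a j = v) (T : V →ₗ[ℝ] V) :
    LinearMap.trace ℝ V T = ∑ j, B (T (a j)) (a' j) := by
  have hT : T = ∑ j, (B.flip (a' j)).smulRight (a j) ∘ₗ T := by
    ext v
    simp [LinearMap.sum_apply, ha]
  have h2 : ∀ j, LinearMap.trace ℝ V ((B.flip (a' j)).smulRight (a j) ∘ₗ T)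
      = B (T (a j)) (a' j) := fun j ↦ by
    have : (B.flip (a' j)).smulRight (a j) ∘ₗ T = (B.flip (a' j) ∘ₗ T).smulRight (a j) := by
      ext v; simp
    rw [this, LinearMap.trace_smulRight]
    simp
  conv_lhs => rw [hT]
  rw [map_sum]
  exact Finset.sum_congr rfl fun j _ ↦ h2 j

end LinearAlgebra

/-! ### Smooth vector fields -/

section Manifold

variable {E : Type*} [NormedAddCommGroup E] [NormedSpace ℝ E] [FiniteDimensional ℝ E]
  {H : Type*} [TopologicalSpace H] {I : ModelWithCorners ℝ E H}
  {M : Type*} [TopologicalSpace M] [ChartedSpace H M] [IsManifold I ∞ M]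
  {X Y : Π p : M, TangentSpace I p} {f : M → ℝ}

theorem IsSmoothField.add (hX : IsSmoothField I X) (hY : IsSmoothField I Y) :
    IsSmoothField I (X + Y) :=
  ContMDiff.add_section hX hY

theorem IsSmoothField.smul (hf : ContMDiff I 𝓘(ℝ) ∞ f) (hX : IsSmoothField I X) :
    IsSmoothField I (f • X) :=
  ContMDiff.smul_section hf hX

theorem IsSmoothField.mdifferentiableAt (hX : IsSmoothField I X) (p : M) :
    MDifferentiableAt I I.tangent (fun q ↦ (⟨q, X q⟩ : TangentBundle I M)) p :=
  (hX p).mdifferentiableAt (by simp)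

theorem exists_isSmoothField [T2Space M] (p : M) (v : TangentSpace I p) :
    ∃ X : Π p : M, TangentSpace I p, IsSmoothField I X ∧ X p = v := by
  obtain ⟨s, hs, hsm⟩ := FiberBundle.exists_contMDiffOn_extend (k := ∞) I E v
  obtain ⟨u, hus, hu, hpu⟩ := mem_nhds_iff.1 hs
  obtain ⟨χ, hχ, -⟩ := (SmoothBumpFunction.nhds_basis_support (I := I) (hu.mem_nhds hpu)).mem_iff.1
    (hu.mem_nhds hpu)
  refine ⟨(χ : M → ℝ) • FiberBundle.extend E v,
    ContMDiffOn.smul_section_of_tsupport χ.contMDiff.contMDiffOn hu hχ (hsm.mono hus), ?_⟩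
  simp

theorem contMDiff_inner (g : SemiRiemannianMetric I M) (hX : IsSmoothField I X)
    (hY : IsSmoothField I Y) : ContMDiff I 𝓘(ℝ) ∞ fun p ↦ g.inner p (X p) (Y p) := by
  have h : ContMDiff I (I.prod 𝓘(ℝ)) ∞
      (fun p ↦ Bundle.TotalSpace.mk' ℝ (E := Bundle.Trivial M ℝ) p (g.inner p (X p) (Y p))) :=
    ContMDiff.clm_bundle_apply₂ (F₁ := E) (F₂ := E) (F₃ := ℝ)
      (E₁ := fun p : M ↦ TangentSpace I p) (E₂ := fun p : M ↦ TangentSpace I p)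
      (b := fun p ↦ p) g.contMDiff hX hY
  intro p
  have := h p
  simp only [Bundle.contMDiffAt_section] at this
  exact this

theorem contMDiff_mvfderiv (hf : ContMDiff I 𝓘(ℝ) ∞ f) (hX : IsSmoothField I X) :
    ContMDiff I 𝓘(ℝ) ∞ fun p ↦ mvfderiv I f p (X p) := by
  have h1 : ContMDiff I 𝓘(ℝ).tangent ∞
      (fun p ↦ tangentMap I 𝓘(ℝ) f (⟨p, X p⟩ : TangentBundle I M)) :=
    (hf.contMDiff_tangentMap (m := ∞) (by simp)).comp hX
  exact (contMDiff_snd_tangentBundle_modelSpace ℝ 𝓘(ℝ)).comp h1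

theorem isSmoothField_mlieBracket (hX : IsSmoothField I X) (hY : IsSmoothField I Y) :
    IsSmoothField I (VectorField.mlieBracket I X Y) := by
  have : IsManifold I (minSmoothness ℝ 2) M := IsManifold.of_le (n := ∞) (by simp; norm_cast)
  have : IsManifold I ((⊤ : ℕ∞) + 1) M := IsManifold.of_le (n := ∞) (by simp)
  exact ContDiff.mlieBracket_vectorField (n := ⊤) (m := ⊤) hX hY (by simp)

end Manifold

section Derivation

variable {E : Type*} [NormedAddCommGroup E] [NormedSpace ℝ E] [FiniteDimensional ℝ E]
  {H : Type*} [TopologicalSpace H] {I : ModelWithCorners ℝ E H}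
  {M : Type*} [TopologicalSpace M] [ChartedSpace H M] [IsManifold I ∞ M]
  {X Y Z : Π p : M, TangentSpace I p} {f : M → ℝ}

theorem mlieBracket_smul (hf : ContMDiff I 𝓘(ℝ) ∞ f) (hY : IsSmoothField I Y) :
    VectorField.mlieBracket I X (f • Y) =
      f • VectorField.mlieBracket I X Y + (fun p ↦ mvfderiv I f p (X p)) • Y := by
  have : IsManifold I 2 M := IsManifold.of_le (n := ∞) (by norm_cast)
  ext p
  rw [VectorField.mlieBracket_smul_right ((hf p).mdifferentiableAt (by simp))
    (hY.mdifferentiableAt p)]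
  simp [add_comm]

theorem mlieBracket_add (hY : IsSmoothField I Y) (hZ : IsSmoothField I Z) :
    VectorField.mlieBracket I X (Y + Z) =
      VectorField.mlieBracket I X Y + VectorField.mlieBracket I X Z := by
  have : IsManifold I 2 M := IsManifold.of_le (n := ∞) (by norm_cast)
  ext p
  rw [VectorField.mlieBracket_add_right (hY.mdifferentiableAt p) (hZ.mdifferentiableAt p)]
  rfl

theorem mlieBracket_jacobi (hX : IsSmoothField I X) (hY : IsSmoothField I Y)
    (hZ : IsSmoothField I Z) :
    VectorField.mlieBracket I X (VectorField.mlieBracket I Y Z) =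
      VectorField.mlieBracket I (VectorField.mlieBracket I X Y) Z +
        VectorField.mlieBracket I Y (VectorField.mlieBracket I X Z) := by
  have : IsManifold I (minSmoothness ℝ 3) M := IsManifold.of_le (n := ∞) (by simp; norm_cast)
  have h2 : minSmoothness ℝ 2 ≤ (∞ : WithTop ℕ∞) := by simp; norm_cast
  exact VectorField.leibniz_identity_mlieBracket (ContMDiff.of_le hX h2) (ContMDiff.of_le hY h2)
    (ContMDiff.of_le hZ h2)

/-- The Lie bracket acts on functions as the commutator of the derivations.  This is read off from
the Jacobi identity for `X`, `Y` and `f • Z`, expanded by the Leibniz rule, with `Z p ≠ 0`. -/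
theorem mvfderiv_mlieBracket [T2Space M] (hX : IsSmoothField I X) (hY : IsSmoothField I Y)
    (hf : ContMDiff I 𝓘(ℝ) ∞ f) (p : M) :
    mvfderiv I f p (VectorField.mlieBracket I X Y p) =
      mvfderiv I (fun q ↦ mvfderiv I f q (Y q)) p (X p)
        - mvfderiv I (fun q ↦ mvfderiv I f q (X q)) p (Y p) := by
  rcases subsingleton_or_nontrivial (TangentSpace I p) with h | h
  · rw [Subsingleton.elim (VectorField.mlieBracket I X Y p) 0, Subsingleton.elim (X p) 0,
      Subsingleton.elim (Y p) 0]
    simp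
  · obtain ⟨z, hz⟩ := exists_ne (0 : TangentSpace I p)
    obtain ⟨Z, hZ, rfl⟩ := exists_isSmoothField p z
    have hXf := contMDiff_mvfderiv hf hX
    have hYf := contMDiff_mvfderiv hf hY
    have hXZ := isSmoothField_mlieBracket hX hZ
    have hYZ := isSmoothField_mlieBracket hY hZ
    have key := congrFun (mlieBracket_jacobi hX hY (hZ.smul hf)) p
    rw [mlieBracket_smul hf hZ, mlieBracket_smul hf hZ, mlieBracket_smul hf hZ,
      mlieBracket_add (hYZ.smul hf) (hZ.smul hYf), mlieBracket_add (hXZ.smul hf) (hZ.smul hXf),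
      mlieBracket_smul hf hYZ, mlieBracket_smul hf hXZ, mlieBracket_smul hYf hZ,
      mlieBracket_smul hXf hZ, mlieBracket_jacobi hX hY hZ] at key
    simp only [Pi.add_apply, Pi.smul_apply', smul_add] at key
    -- In the Jacobi identity all terms but the ones proportional to `Z p` cancel.
    have h0 : (mvfderiv I f p (VectorField.mlieBracket I X Y p)
        - (mvfderiv I (fun q ↦ mvfderiv I f q (Y q)) p (X p)
        - mvfderiv I (fun q ↦ mvfderiv I f q (X q)) p (Y p))) • Z p = 0 := by
      rw [sub_smul, sub_smul]
      rw [← sub_eq_zero] at key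
      rw [← neg_eq_zero, ← key]
      abel
    exact sub_eq_zero.1 ((smul_eq_zero.1 h0).resolve_right hz)

end Derivation

/-! ### Lawful algebroids and tensoriality -/

section Lawful

variable {E : Type*} [NormedAddCommGroup E] [NormedSpace ℝ E] [FiniteDimensional ℝ E]
  {H : Type*} [TopologicalSpace H] {I : ModelWithCorners ℝ E H}
  {M : Type*} [TopologicalSpace M] [ChartedSpace H M] [IsManifold I ∞ M]
  {V : M → Type*} [∀ p, AddCommGroup (V p)] [∀ p, Module ℝ (V p)]

/-- The laws of a semi-Riemannian algebroid that the construction of the Levi-Civita connection and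
of its curvature tensor rests on.  The Jacobi identity is not among them: what tensoriality of the
curvature needs is that the anchor is compatible with the brackets. -/
structure SRAlgebroid.IsLawful (𝔞 : SRAlgebroid I V) : Prop where
  smooth_add {S T : Π p, V p} : 𝔞.IsSmooth S → 𝔞.IsSmooth T → 𝔞.IsSmooth (S + T)
  smooth_smul {f : M → ℝ} {S : Π p, V p} :
    ContMDiff I 𝓘(ℝ) ∞ f → 𝔞.IsSmooth S → 𝔞.IsSmooth (f • S)
  exists_smooth (p : M) (v : V p) : ∃ S, 𝔞.IsSmooth S ∧ S p = v
  finrank_eq (p q : M) : Module.finrank ℝ (V p) = Module.finrank ℝ (V q)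
  metric_symm (p : M) (v w : V p) : 𝔞.metric p v w = 𝔞.metric p w v
  smooth_pairing {S T : Π p, V p} :
    𝔞.IsSmooth S → 𝔞.IsSmooth T → ContMDiff I 𝓘(ℝ) ∞ (𝔞.pairing S T)
  smooth_of_pairing {S : Π p, V p} :
    (∀ T, 𝔞.IsSmooth T → ContMDiff I 𝓘(ℝ) ∞ (𝔞.pairing S T)) → 𝔞.IsSmooth S
  smooth_anchor {S : Π p, V p} : 𝔞.IsSmooth S → IsSmoothField I (fun p ↦ 𝔞.anchor p (S p))
  smooth_bracket {S T : Π p, V p} : 𝔞.IsSmooth S → 𝔞.IsSmooth T → 𝔞.IsSmooth (𝔞.bracket S T)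
  bracket_swap {S T : Π p, V p} :
    𝔞.IsSmooth S → 𝔞.IsSmooth T → 𝔞.bracket S T = - 𝔞.bracket T S
  bracket_add {U S T : Π p, V p} : 𝔞.IsSmooth U → 𝔞.IsSmooth S → 𝔞.IsSmooth T →
    𝔞.bracket U (S + T) = 𝔞.bracket U S + 𝔞.bracket U T
  bracket_smul {f : M → ℝ} {S T : Π p, V p} :
    ContMDiff I 𝓘(ℝ) ∞ f → 𝔞.IsSmooth S → 𝔞.IsSmooth T →
    𝔞.bracket S (f • T) = f • 𝔞.bracket S T + (𝔞.deriv S f) • T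
  anchor_bracket {S T : Π p, V p} (p : M) : 𝔞.IsSmooth S → 𝔞.IsSmooth T →
    𝔞.anchor p (𝔞.bracket S T p) =
      VectorField.mlieBracket I (fun q ↦ 𝔞.anchor q (S q)) (fun q ↦ 𝔞.anchor q (T q)) p

namespace SRAlgebroid

variable {𝔞 : SRAlgebroid I V}

section Deriv

variable {U S T : Π p, V p} {f h : M → ℝ}

theorem deriv_add_left (U S : Π p, V p) (f : M → ℝ) :
    𝔞.deriv (U + S) f = 𝔞.deriv U f + 𝔞.deriv S f := by
  ext p; simp [deriv]

theorem deriv_smul_left (h : M → ℝ) (U : Π p, V p) (f : M → ℝ) :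
    𝔞.deriv (h • U) f = h * 𝔞.deriv U f := by
  ext p; simp [deriv]

theorem deriv_add (hf : ContMDiff I 𝓘(ℝ) ∞ f) (hh : ContMDiff I 𝓘(ℝ) ∞ h) :
    𝔞.deriv U (f + h) = 𝔞.deriv U f + 𝔞.deriv U h := by
  ext p
  simp [deriv, mvfderiv_add ((hf p).mdifferentiableAt (by simp))
    ((hh p).mdifferentiableAt (by simp))]

theorem deriv_mul (hf : ContMDiff I 𝓘(ℝ) ∞ f) (hh : ContMDiff I 𝓘(ℝ) ∞ h) :
    𝔞.deriv U (f * h) = f * 𝔞.deriv U h + h * 𝔞.deriv U f := by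
  ext p
  simp [deriv, mvfderiv_mul ((hf p).mdifferentiableAt (by simp))
    ((hh p).mdifferentiableAt (by simp))]

theorem deriv_const (c : ℝ) : 𝔞.deriv U (fun _ ↦ c) = 0 := by
  ext p
  simp [deriv, mvfderiv_const]

theorem pairing_add_left (U S T : Π p, V p) :
    𝔞.pairing (U + S) T = 𝔞.pairing U T + 𝔞.pairing S T := by
  ext p; simp [pairing]

theorem pairing_add_right (U S T : Π p, V p) :
    𝔞.pairing U (S + T) = 𝔞.pairing U S + 𝔞.pairing U T := by
  ext p; simp [pairing]

theorem pairing_smul_left (f : M → ℝ) (U S : Π p, V p) :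
    𝔞.pairing (f • U) S = f * 𝔞.pairing U S := by
  ext p; simp [pairing]

theorem pairing_smul_right (f : M → ℝ) (U S : Π p, V p) :
    𝔞.pairing U (f • S) = f * 𝔞.pairing U S := by
  ext p; simp [pairing]

theorem pairing_neg_left (U S : Π p, V p) : 𝔞.pairing (-U) S = - 𝔞.pairing U S := by
  ext p; simp [pairing]

end Deriv

/-- Up to a smooth factor that does not vanish at `p`, every smooth section is a combination of
finitely many fixed smooth sections, with smooth coefficients: take smooth sections `e i` that form
a basis at `p`, and the square of the determinant of their Gram matrix as the factor.  (The square
makes the identity trivially true where the `e i` are dependent.)  Only three of the laws are used,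
and they are separate hypotheses because the lemma serves to prove one of the other laws for `TM`. -/
theorem exists_frame [∀ p, FiniteDimensional ℝ (V p)]
    (hex : ∀ (p : M) (v : V p), ∃ S, 𝔞.IsSmooth S ∧ S p = v)
    (hrank : ∀ p q : M, Module.finrank ℝ (V p) = Module.finrank ℝ (V q))
    (hpair : ∀ {S T : Π p, V p}, 𝔞.IsSmooth S → 𝔞.IsSmooth T →
      ContMDiff I 𝓘(ℝ) ∞ (𝔞.pairing S T)) (p : M) :
    ∃ (n : ℕ) (e : Fin n → Π q, V q) (χ : M → ℝ), (∀ i, 𝔞.IsSmooth (e i)) ∧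
      ContMDiff I 𝓘(ℝ) ∞ χ ∧ χ p ≠ 0 ∧ ∀ S, (∀ i, ContMDiff I 𝓘(ℝ) ∞ (𝔞.pairing S (e i))) →
        ∃ c : Fin n → M → ℝ, (∀ i, ContMDiff I 𝓘(ℝ) ∞ (c i)) ∧
          χ • S = ∑ i, c i • e i ∧ (S p = 0 → ∀ i, c i p = 0) := by
  classical
  choose e he hep using fun i ↦ hex p (Module.finBasis ℝ (V p) i)
  let G (q : M) : Matrix _ _ ℝ := Matrix.of fun i j ↦ 𝔞.metric q (e i q) (e j q)
  have hG : ∀ i j, ContMDiff I 𝓘(ℝ) ∞ fun q ↦ G q i j := fun i j ↦ hpair (he i) (he j)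
  have hdet : ContMDiff I 𝓘(ℝ) ∞ fun q ↦ (G q).det := by
    simp only [Matrix.det_apply']
    exact contMDiff_finsetSum fun σ _ ↦ contMDiff_const.mul (contMDiff_finsetProd fun i _ ↦ hG _ _)
  have hadj : ∀ i j, ContMDiff I 𝓘(ℝ) ∞ fun q ↦ (G q).adjugate i j := by
    intro i j
    simp only [Matrix.adjugate_apply, Matrix.det_apply']
    refine contMDiff_finsetSum fun σ _ ↦ contMDiff_const.mul (contMDiff_finsetProd fun k _ ↦ ?_)
    by_cases h : σ k = j
    · simp only [h, Matrix.updateRow_self]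
      exact contMDiff_const
    · simp only [Matrix.updateRow_ne h]
      exact hG _ _
  refine ⟨_, e, fun q ↦ (G q).det * (G q).det, he, hdet.mul hdet, ?_, fun S hS ↦ ⟨fun i q ↦
    (G q).det * ∑ j, 𝔞.metric q (S q) (e j q) * (G q).adjugate j i, fun i ↦ hdet.mul
      (contMDiff_finsetSum fun j _ ↦ (hS j).mul (hadj j i)), ?_, fun h i ↦ by simp [h]⟩⟩
  · have := det_gram_basis_ne_zero (𝔞.metric p) (𝔞.nondegenerate p) (Module.finBasis ℝ (V p))
    simp only [← hep] at this
    exact mul_ne_zero this this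
  · ext q
    simp only [Finset.sum_apply, Pi.smul_apply', mul_smul, ← Finset.smul_sum]
    by_cases h : (G q).det = 0
    · simp [h]
    · congr 1
      exact det_gram_smul_eq (𝔞.metric q) (hrank p q) (fun i ↦ e i q) h (S q)

namespace IsLawful

variable {U S T W : Π p, V p} {f h : M → ℝ}

theorem pairing_comm (h𝔞 : 𝔞.IsLawful) (S T : Π p, V p) : 𝔞.pairing S T = 𝔞.pairing T S := by
  ext p; exact h𝔞.metric_symm ..

theorem smooth_deriv (h𝔞 : 𝔞.IsLawful) (hU : 𝔞.IsSmooth U) (hf : ContMDiff I 𝓘(ℝ) ∞ f) :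
    ContMDiff I 𝓘(ℝ) ∞ (𝔞.deriv U f) :=
  contMDiff_mvfderiv hf (h𝔞.smooth_anchor hU)

theorem deriv_bracket [T2Space M] (h𝔞 : 𝔞.IsLawful) (hU : 𝔞.IsSmooth U) (hS : 𝔞.IsSmooth S)
    (hf : ContMDiff I 𝓘(ℝ) ∞ f) :
    𝔞.deriv (𝔞.bracket U S) f = 𝔞.deriv U (𝔞.deriv S f) - 𝔞.deriv S (𝔞.deriv U f) := by
  ext p
  have := mvfderiv_mlieBracket (h𝔞.smooth_anchor hU) (h𝔞.smooth_anchor hS) hf p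
  rw [← h𝔞.anchor_bracket p hU hS] at this
  exact this

theorem smooth_zero (h𝔞 : 𝔞.IsLawful) : 𝔞.IsSmooth 0 :=
  h𝔞.smooth_of_pairing fun T _ ↦ by
    have : 𝔞.pairing 0 T = fun _ ↦ 0 := by ext p; simp [pairing]
    rw [this]
    exact contMDiff_const

theorem smooth_neg (h𝔞 : 𝔞.IsLawful) (hS : 𝔞.IsSmooth S) : 𝔞.IsSmooth (-S) := by
  have : -S = (fun _ : M ↦ (-1 : ℝ)) • S := by ext p; simp
  rw [this]
  exact h𝔞.smooth_smul contMDiff_const hS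

theorem smooth_sum (h𝔞 : 𝔞.IsLawful) {ι : Type*} (s : Finset ι) (F : ι → Π p, V p)
    (hF : ∀ i, 𝔞.IsSmooth (F i)) : 𝔞.IsSmooth (∑ i ∈ s, F i) :=
  Finset.sum_induction _ _ (fun _ _ ↦ h𝔞.smooth_add) h𝔞.smooth_zero fun i _ ↦ hF i

theorem bracket_smul_left (h𝔞 : 𝔞.IsLawful) (hf : ContMDiff I 𝓘(ℝ) ∞ f) (hS : 𝔞.IsSmooth S)
    (hT : 𝔞.IsSmooth T) : 𝔞.bracket (f • S) T = f • 𝔞.bracket S T - (𝔞.deriv T f) • S := by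
  rw [h𝔞.bracket_swap (h𝔞.smooth_smul hf hS) hT, h𝔞.bracket_smul hf hT hS, h𝔞.bracket_swap hT hS]
  ext p
  simp [sub_eq_add_neg, add_comm]

theorem bracket_add_left (h𝔞 : 𝔞.IsLawful) (hU : 𝔞.IsSmooth U) (hS : 𝔞.IsSmooth S)
    (hT : 𝔞.IsSmooth T) : 𝔞.bracket (U + S) T = 𝔞.bracket U T + 𝔞.bracket S T := by
  rw [h𝔞.bracket_swap (h𝔞.smooth_add hU hS) hT, h𝔞.bracket_add hT hU hS, h𝔞.bracket_swap hT hS,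
    h𝔞.bracket_swap hT hU]
  simp [add_comm]

section Tensorial

variable [∀ p, FiniteDimensional ℝ (V p)] {A : Type*} [AddCommGroup A] [Module ℝ A]

variable (𝔞) in
/-- Linearity over the smooth functions, evaluated at `p`, of an operation on smooth sections. -/
structure Tensorial (p : M) (Φ : (Π p, V p) → A) : Prop where
  add {S T : Π p, V p} : 𝔞.IsSmooth S → 𝔞.IsSmooth T → Φ (S + T) = Φ S + Φ T
  smul {f : M → ℝ} {S : Π p, V p} :
    ContMDiff I 𝓘(ℝ) ∞ f → 𝔞.IsSmooth S → Φ (f • S) = f p • Φ S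

theorem exists_linearMap (h𝔞 : 𝔞.IsLawful) {p : M} {Φ : (Π p, V p) → A} (hΦ : Tensorial 𝔞 p Φ) :
    ∃ L : V p →ₗ[ℝ] A, ∀ S, 𝔞.IsSmooth S → L (S p) = Φ S := by
  have h0 : Φ 0 = 0 := by simpa using hΦ.add h𝔞.smooth_zero h𝔞.smooth_zero
  have hsum : ∀ {ι : Type} (s : Finset ι) (F : ι → Π p, V p), (∀ i, 𝔞.IsSmooth (F i)) →
      Φ (∑ i ∈ s, F i) = ∑ i ∈ s, Φ (F i) := by
    intro ι s F hF
    classical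
    induction s using Finset.induction_on with
    | empty => simpa
    | insert i s hi ih =>
      rw [Finset.sum_insert hi, Finset.sum_insert hi, hΦ.add (hF i) (h𝔞.smooth_sum _ _ hF), ih]
  obtain ⟨n, e, χ, he, hχ, hχp, hfr⟩ :=
    exists_frame h𝔞.exists_smooth h𝔞.finrank_eq h𝔞.smooth_pairing p
  -- If `S p = 0`, the coefficients of `χ • S` in the frame vanish at `p`, hence so does `Φ S`.
  have hvan : ∀ S, 𝔞.IsSmooth S → S p = 0 → Φ S = 0 := by
    intro S hS hSp
    obtain ⟨c, hc, hχS, hc0⟩ := hfr S fun i ↦ h𝔞.smooth_pairing hS (he i)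
    have h1 : χ p • Φ S = 0 := by
      rw [← hΦ.smul hχ hS, hχS, hsum _ _ fun i ↦ h𝔞.smooth_smul (hc i) (he i)]
      exact Finset.sum_eq_zero fun i _ ↦ by rw [hΦ.smul (hc i) (he i), hc0 hSp, zero_smul]
    exact (smul_eq_zero.1 h1).resolve_left hχp
  choose X hX hXp using h𝔞.exists_smooth p
  have hneg : ∀ S, 𝔞.IsSmooth S → Φ (-S) = - Φ S := fun S hS ↦ by
    have := hΦ.add hS (h𝔞.smooth_neg hS)
    rw [add_neg_cancel, h0] at this
    exact (neg_eq_of_add_eq_zero_right this.symm).symm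
  have hval : ∀ S T, 𝔞.IsSmooth S → 𝔞.IsSmooth T → S p = T p → Φ S = Φ T := by
    intro S T hS hT h
    have := hvan (S + -T) (h𝔞.smooth_add hS (h𝔞.smooth_neg hT)) (by simp [h])
    rw [hΦ.add hS (h𝔞.smooth_neg hT), hneg T hT] at this
    exact add_neg_eq_zero.1 this
  refine ⟨{ toFun := fun v ↦ Φ (X v), map_add' := fun v w ↦ ?_, map_smul' := fun c v ↦ ?_ },
    fun S hS ↦ hval _ _ (hX _) hS (hXp _)⟩
  · rw [← hΦ.add (hX v) (hX w)]
    exact hval _ _ (hX _) (h𝔞.smooth_add (hX v) (hX w)) (by simp [hXp])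
  · have := hΦ.smul (f := fun _ ↦ c) contMDiff_const (hX v)
    rw [RingHom.id_apply, ← this]
    exact hval _ _ (hX _) (h𝔞.smooth_smul contMDiff_const (hX v)) (by simp [hXp])

theorem linearMap_ext (h𝔞 : 𝔞.IsLawful) {p : M} {L L' : V p →ₗ[ℝ] A}
    (h : ∀ S, 𝔞.IsSmooth S → L (S p) = L' (S p)) : L = L' := by
  ext v
  obtain ⟨S, hS, rfl⟩ := h𝔞.exists_smooth p v
  exact h S hS

theorem exists_linearMap₂ (h𝔞 : 𝔞.IsLawful) {p : M} {Φ : (Π p, V p) → (Π p, V p) → A}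
    (h₁ : ∀ T, 𝔞.IsSmooth T → Tensorial 𝔞 p fun S ↦ Φ S T)
    (h₂ : ∀ S, 𝔞.IsSmooth S → Tensorial 𝔞 p (Φ S)) :
    ∃ L : V p →ₗ[ℝ] V p →ₗ[ℝ] A, ∀ S T, 𝔞.IsSmooth S → 𝔞.IsSmooth T →
      L (S p) (T p) = Φ S T := by
  -- `Ψ S` is the linear map induced by `Φ S`; it is junk when `S` is not smooth.
  have hex : ∀ S, ∃ L : V p →ₗ[ℝ] A, 𝔞.IsSmooth S → ∀ T, 𝔞.IsSmooth T → L (T p) = Φ S T := by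
    intro S
    by_cases hS : 𝔞.IsSmooth S
    · obtain ⟨L, hL⟩ := h𝔞.exists_linearMap (h₂ S hS)
      exact ⟨L, fun _ ↦ hL⟩
    · exact ⟨0, fun h ↦ absurd h hS⟩
  choose Ψ hΨ using hex
  have hT : Tensorial 𝔞 p Ψ := by
    refine ⟨fun {S T} hS hT ↦ h𝔞.linearMap_ext fun W hW ↦ ?_,
      fun {f S} hf hS ↦ h𝔞.linearMap_ext fun W hW ↦ ?_⟩
    · rw [hΨ _ (h𝔞.smooth_add hS hT) W hW, LinearMap.add_apply, hΨ S hS W hW, hΨ T hT W hW]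
      exact (h₁ W hW).add hS hT
    · rw [hΨ _ (h𝔞.smooth_smul hf hS) W hW, LinearMap.smul_apply, hΨ S hS W hW]
      exact (h₁ W hW).smul hf hS
  obtain ⟨L, hL⟩ := h𝔞.exists_linearMap hT
  exact ⟨L, fun S T hS hT ↦ by rw [hL S hS, hΨ S hS T hT]⟩

theorem exists_linearMap₃ (h𝔞 : 𝔞.IsLawful) {p : M}
    {Φ : (Π p, V p) → (Π p, V p) → (Π p, V p) → A}
    (h₁ : ∀ T W, 𝔞.IsSmooth T → 𝔞.IsSmooth W → Tensorial 𝔞 p fun S ↦ Φ S T W)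
    (h₂ : ∀ S W, 𝔞.IsSmooth S → 𝔞.IsSmooth W → Tensorial 𝔞 p fun T ↦ Φ S T W)
    (h₃ : ∀ S T, 𝔞.IsSmooth S → 𝔞.IsSmooth T → Tensorial 𝔞 p (Φ S T)) :
    ∃ L : V p →ₗ[ℝ] V p →ₗ[ℝ] V p →ₗ[ℝ] A, ∀ S T W, 𝔞.IsSmooth S → 𝔞.IsSmooth T →
      𝔞.IsSmooth W → L (S p) (T p) (W p) = Φ S T W := by
  have hex : ∀ S, ∃ L : V p →ₗ[ℝ] V p →ₗ[ℝ] A, 𝔞.IsSmooth S → ∀ T W, 𝔞.IsSmooth T →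
      𝔞.IsSmooth W → L (T p) (W p) = Φ S T W := by
    intro S
    by_cases hS : 𝔞.IsSmooth S
    · obtain ⟨L, hL⟩ := h𝔞.exists_linearMap₂ (fun W hW ↦ h₂ S W hS hW) fun T hT ↦ h₃ S T hS hT
      exact ⟨L, fun _ ↦ hL⟩
    · exact ⟨0, fun h ↦ absurd h hS⟩
  choose Ψ hΨ using hex
  have hT : Tensorial 𝔞 p Ψ := by
    refine ⟨fun {S T} hS hT ↦ h𝔞.linearMap_ext fun W hW ↦ h𝔞.linearMap_ext fun Z hZ ↦ ?_,
      fun {f S} hf hS ↦ h𝔞.linearMap_ext fun W hW ↦ h𝔞.linearMap_ext fun Z hZ ↦ ?_⟩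
    · rw [hΨ _ (h𝔞.smooth_add hS hT) W Z hW hZ, LinearMap.add_apply, LinearMap.add_apply,
        hΨ S hS W Z hW hZ, hΨ T hT W Z hW hZ]
      exact (h₁ W Z hW hZ).add hS hT
    · rw [hΨ _ (h𝔞.smooth_smul hf hS) W Z hW hZ, LinearMap.smul_apply, LinearMap.smul_apply,
        hΨ S hS W Z hW hZ]
      exact (h₁ W Z hW hZ).smul hf hS
  obtain ⟨L, hL⟩ := h𝔞.exists_linearMap hT
  exact ⟨L, fun S T W hS hT hW ↦ by rw [hL S hS, hΨ S hS T W hT hW]⟩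

end Tensorial

end IsLawful
end SRAlgebroid
end Lawful

/-! ### The Levi-Civita connection and its curvature -/

namespace SRAlgebroid.IsLawful

variable {E : Type*} [NormedAddCommGroup E] [NormedSpace ℝ E] [FiniteDimensional ℝ E]
  {H : Type*} [TopologicalSpace H] {I : ModelWithCorners ℝ E H}
  {M : Type*} [TopologicalSpace M] [ChartedSpace H M] [IsManifold I ∞ M]
  {V : M → Type*} [∀ p, AddCommGroup (V p)] [∀ p, Module ℝ (V p)]
  [∀ p, FiniteDimensional ℝ (V p)]
  {𝔞 : SRAlgebroid I V} {U S T W : Π p, V p} {f h : M → ℝ}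

/-- The derivatives of `f` that appear in the Koszul formula for `f • W` cancel. -/
theorem koszul_tensorial (h𝔞 : 𝔞.IsLawful) (hU : 𝔞.IsSmooth U) (hS : 𝔞.IsSmooth S) (p : M) :
    Tensorial 𝔞 p fun W ↦ 𝔞.koszul U S W p := by
  refine ⟨fun {W Z} hW hZ ↦ ?_, fun {f W} hf hW ↦ ?_⟩
  · simp only [koszul, pairing_add_right, pairing_add_left, deriv_add_left,
      h𝔞.bracket_add hS hW hZ, h𝔞.bracket_add_left hW hZ hU,
      deriv_add (h𝔞.smooth_pairing hS hW) (h𝔞.smooth_pairing hS hZ),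
      deriv_add (h𝔞.smooth_pairing hW hU) (h𝔞.smooth_pairing hZ hU), Pi.add_apply]
    ring
  · simp only [koszul, pairing_smul_right, pairing_smul_left, deriv_smul_left,
      h𝔞.bracket_smul hf hS hW, h𝔞.bracket_smul_left hf hW hU, sub_eq_add_neg,
      pairing_add_left, pairing_neg_left,
      deriv_mul hf (h𝔞.smooth_pairing hS hW),
      deriv_mul hf (h𝔞.smooth_pairing hU hW), Pi.add_apply, Pi.mul_apply, Pi.neg_apply,
      h𝔞.pairing_comm W U, h𝔞.pairing_comm W S]
    simp only [smul_eq_mul]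
    ring

/-- The defining property of the connection: the vector it is chosen as exists. -/
theorem conn_spec (h𝔞 : 𝔞.IsLawful) (hU : 𝔞.IsSmooth U) (hS : 𝔞.IsSmooth S) (hW : 𝔞.IsSmooth W)
    (p : M) : 2 * 𝔞.metric p (𝔞.conn U S p) (W p) = 𝔞.koszul U S W p := by
  have hex : ∃ v : V p, ∀ W : Π p, V p, 𝔞.IsSmooth W →
      2 * 𝔞.metric p v (W p) = 𝔞.koszul U S W p := by
    obtain ⟨L, hL⟩ := h𝔞.exists_linearMap (h𝔞.koszul_tensorial hU hS p)
    refine ⟨((𝔞.metric p).toDual (𝔞.nondegenerate p)).symm ((1 / 2 : ℝ) • L), fun W hW ↦ ?_⟩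
    rw [LinearMap.BilinForm.apply_toDual_symm_apply, ← hL W hW]
    simp
  exact Classical.epsilon_spec hex W hW

theorem eq_of_metric (h𝔞 : 𝔞.IsLawful) {p : M} {v w : V p}
    (h : ∀ W, 𝔞.IsSmooth W → 𝔞.metric p v (W p) = 𝔞.metric p w (W p)) : v = w := by
  rw [← sub_eq_zero]
  refine (𝔞.nondegenerate p).1 _ fun z ↦ ?_
  obtain ⟨W, hW, rfl⟩ := h𝔞.exists_smooth p z
  simp [h W hW]

theorem pairing_conn (h𝔞 : 𝔞.IsLawful) (hU : 𝔞.IsSmooth U) (hS : 𝔞.IsSmooth S)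
    (hW : 𝔞.IsSmooth W) (p : M) :
    𝔞.metric p (𝔞.conn U S p) (W p) = 1 / 2 * 𝔞.koszul U S W p := by
  rw [← h𝔞.conn_spec hU hS hW]; ring

theorem smooth_conn (h𝔞 : 𝔞.IsLawful) (hU : 𝔞.IsSmooth U) (hS : 𝔞.IsSmooth S) :
    𝔞.IsSmooth (𝔞.conn U S) := by
  refine h𝔞.smooth_of_pairing fun W hW ↦ ?_
  have : 𝔞.pairing (𝔞.conn U S) W = fun p ↦ 1 / 2 * 𝔞.koszul U S W p :=
    funext fun p ↦ h𝔞.pairing_conn hU hS hW p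
  rw [this]
  refine contMDiff_const.mul ?_
  exact (((((h𝔞.smooth_deriv hU (h𝔞.smooth_pairing hS hW)).add
    (h𝔞.smooth_deriv hS (h𝔞.smooth_pairing hW hU))).sub
    (h𝔞.smooth_deriv hW (h𝔞.smooth_pairing hU hS))).add
    (h𝔞.smooth_pairing (h𝔞.smooth_bracket hU hS) hW)).sub
    (h𝔞.smooth_pairing (h𝔞.smooth_bracket hS hW) hU)).add
    (h𝔞.smooth_pairing (h𝔞.smooth_bracket hW hU) hS)

theorem conn_torsion (h𝔞 : 𝔞.IsLawful) (hU : 𝔞.IsSmooth U) (hS : 𝔞.IsSmooth S) :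
    𝔞.conn U S = 𝔞.conn S U + 𝔞.bracket U S := by
  ext p
  refine h𝔞.eq_of_metric fun W hW ↦ ?_
  rw [Pi.add_apply, map_add, LinearMap.add_apply, h𝔞.pairing_conn hU hS hW,
    h𝔞.pairing_conn hS hU hW]
  change _ = _ + 𝔞.pairing (𝔞.bracket U S) W p
  simp only [koszul, h𝔞.bracket_swap hS hU, h𝔞.bracket_swap hW hU, h𝔞.bracket_swap hW hS,
    pairing_neg_left, h𝔞.pairing_comm S U, h𝔞.pairing_comm S W, h𝔞.pairing_comm U W, Pi.neg_apply]
  ring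

theorem deriv_pairing (h𝔞 : 𝔞.IsLawful) (hU : 𝔞.IsSmooth U) (hS : 𝔞.IsSmooth S)
    (hT : 𝔞.IsSmooth T) :
    𝔞.deriv U (𝔞.pairing S T) = 𝔞.pairing (𝔞.conn U S) T + 𝔞.pairing S (𝔞.conn U T) := by
  ext p
  rw [h𝔞.pairing_comm S (𝔞.conn U T)]
  change _ = 𝔞.metric p (𝔞.conn U S p) (T p) + 𝔞.metric p (𝔞.conn U T p) (S p)
  rw [h𝔞.pairing_conn hU hS hT, h𝔞.pairing_conn hU hT hS]
  simp only [koszul, h𝔞.bracket_swap hS hU, h𝔞.bracket_swap hT hU, h𝔞.bracket_swap hT hS,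
    pairing_neg_left, h𝔞.pairing_comm T S, h𝔞.pairing_comm U T, h𝔞.pairing_comm U S, Pi.neg_apply]
  ring

theorem conn_add_right (h𝔞 : 𝔞.IsLawful) (hU : 𝔞.IsSmooth U) (hS : 𝔞.IsSmooth S)
    (hT : 𝔞.IsSmooth T) : 𝔞.conn U (S + T) = 𝔞.conn U S + 𝔞.conn U T := by
  ext p
  refine h𝔞.eq_of_metric fun W hW ↦ ?_
  rw [Pi.add_apply, map_add, LinearMap.add_apply, h𝔞.pairing_conn hU hS hW,
    h𝔞.pairing_conn hU hT hW, h𝔞.pairing_conn hU (h𝔞.smooth_add hS hT) hW]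
  simp only [koszul, pairing_add_right, pairing_add_left, deriv_add_left,
      h𝔞.bracket_add hU hS hT, h𝔞.bracket_add_left hS hT hW,
      deriv_add (h𝔞.smooth_pairing hS hW) (h𝔞.smooth_pairing hT hW),
      deriv_add (h𝔞.smooth_pairing hU hS) (h𝔞.smooth_pairing hU hT), Pi.add_apply]
  ring

theorem conn_smul_right (h𝔞 : 𝔞.IsLawful) (hU : 𝔞.IsSmooth U) (hf : ContMDiff I 𝓘(ℝ) ∞ f)
    (hS : 𝔞.IsSmooth S) : 𝔞.conn U (f • S) = f • 𝔞.conn U S + 𝔞.deriv U f • S := by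
  ext p
  refine h𝔞.eq_of_metric fun W hW ↦ ?_
  rw [h𝔞.pairing_conn hU (h𝔞.smooth_smul hf hS) hW]
  simp only [Pi.add_apply, Pi.smul_apply', map_add, map_smul, LinearMap.add_apply,
    LinearMap.smul_apply, h𝔞.pairing_conn hU hS hW, smul_eq_mul]
  change _ = _ + _ * 𝔞.pairing S W p
  simp only [koszul, pairing_smul_right, pairing_smul_left, deriv_smul_left,
      h𝔞.bracket_smul hf hU hS, h𝔞.bracket_smul_left hf hS hW, sub_eq_add_neg,
      pairing_add_left, pairing_neg_left,
      deriv_mul hf (h𝔞.smooth_pairing hS hW),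
      deriv_mul hf (h𝔞.smooth_pairing hS hU), Pi.add_apply, Pi.mul_apply, Pi.neg_apply,
      h𝔞.pairing_comm U S]
  ring

theorem conn_add_left (h𝔞 : 𝔞.IsLawful) (hU : 𝔞.IsSmooth U) (hS : 𝔞.IsSmooth S)
    (hT : 𝔞.IsSmooth T) : 𝔞.conn (U + S) T = 𝔞.conn U T + 𝔞.conn S T := by
  rw [h𝔞.conn_torsion (h𝔞.smooth_add hU hS) hT, h𝔞.conn_torsion hU hT, h𝔞.conn_torsion hS hT,
    h𝔞.conn_add_right hT hU hS, h𝔞.bracket_add_left hU hS hT]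
  abel

theorem conn_smul_left (h𝔞 : 𝔞.IsLawful) (hf : ContMDiff I 𝓘(ℝ) ∞ f) (hU : 𝔞.IsSmooth U)
    (hT : 𝔞.IsSmooth T) : 𝔞.conn (f • U) T = f • 𝔞.conn U T := by
  rw [h𝔞.conn_torsion (h𝔞.smooth_smul hf hU) hT, h𝔞.conn_torsion hU hT,
    h𝔞.conn_smul_right hT hf hU, h𝔞.bracket_smul_left hf hU hT, smul_add]
  abel

theorem conn_neg_left (h𝔞 : 𝔞.IsLawful) (hU : 𝔞.IsSmooth U) (hT : 𝔞.IsSmooth T) :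
    𝔞.conn (-U) T = - 𝔞.conn U T := by
  have := h𝔞.conn_smul_left (f := fun _ ↦ (-1 : ℝ)) contMDiff_const hU hT
  have h1 : ∀ Z : Π p, V p, (fun _ : M ↦ (-1 : ℝ)) • Z = -Z := fun Z ↦ by ext p; simp
  rwa [h1, h1] at this

theorem conn_zero_left (h𝔞 : 𝔞.IsLawful) (hT : 𝔞.IsSmooth T) : 𝔞.conn 0 T = 0 := by
  simpa using h𝔞.conn_add_left h𝔞.smooth_zero h𝔞.smooth_zero hT

theorem conn_zero_right (h𝔞 : 𝔞.IsLawful) (hU : 𝔞.IsSmooth U) : 𝔞.conn U 0 = 0 := by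
  simpa using h𝔞.conn_add_right hU h𝔞.smooth_zero h𝔞.smooth_zero

theorem conn_neg_right (h𝔞 : 𝔞.IsLawful) (hU : 𝔞.IsSmooth U) (hT : 𝔞.IsSmooth T) :
    𝔞.conn U (-T) = - 𝔞.conn U T := by
  have := h𝔞.conn_add_right hU hT (h𝔞.smooth_neg hT)
  rw [add_neg_cancel, h𝔞.conn_zero_right hU] at this
  exact (neg_eq_of_add_eq_zero_right this.symm).symm

theorem curvatureOp_swap (h𝔞 : 𝔞.IsLawful) (hU : 𝔞.IsSmooth U) (hS : 𝔞.IsSmooth S)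
    (hW : 𝔞.IsSmooth W) : 𝔞.curvatureOp U S W = - 𝔞.curvatureOp S U W := by
  simp only [curvatureOp]
  rw [h𝔞.bracket_swap hU hS, h𝔞.conn_neg_left (h𝔞.smooth_bracket hS hU) hW]
  abel

theorem curvatureOp_add_left (h𝔞 : 𝔞.IsLawful) (hU : 𝔞.IsSmooth U) (hT : 𝔞.IsSmooth T)
    (hS : 𝔞.IsSmooth S) (hW : 𝔞.IsSmooth W) :
    𝔞.curvatureOp (U + T) S W = 𝔞.curvatureOp U S W + 𝔞.curvatureOp T S W := by
  simp only [curvatureOp]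
  rw [h𝔞.conn_add_left hU hT (h𝔞.smooth_conn hS hW), h𝔞.conn_add_left hU hT hW,
    h𝔞.conn_add_right hS (h𝔞.smooth_conn hU hW) (h𝔞.smooth_conn hT hW),
    h𝔞.bracket_add_left hU hT hS,
    h𝔞.conn_add_left (h𝔞.smooth_bracket hU hS) (h𝔞.smooth_bracket hT hS) hW]
  abel

theorem curvatureOp_smul_left (h𝔞 : 𝔞.IsLawful) (hf : ContMDiff I 𝓘(ℝ) ∞ f)
    (hU : 𝔞.IsSmooth U) (hS : 𝔞.IsSmooth S) (hW : 𝔞.IsSmooth W) :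
    𝔞.curvatureOp (f • U) S W = f • 𝔞.curvatureOp U S W := by
  have hSf := h𝔞.smooth_deriv hS hf
  simp only [curvatureOp]
  rw [h𝔞.conn_smul_left hf hU (h𝔞.smooth_conn hS hW), h𝔞.conn_smul_left hf hU hW,
    h𝔞.conn_smul_right hS hf (h𝔞.smooth_conn hU hW), h𝔞.bracket_smul_left hf hU hS,
    sub_eq_add_neg (f • 𝔞.bracket U S),
    h𝔞.conn_add_left (h𝔞.smooth_smul hf (h𝔞.smooth_bracket hU hS))
      (h𝔞.smooth_neg (h𝔞.smooth_smul hSf hU)) hW,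
    h𝔞.conn_neg_left (h𝔞.smooth_smul hSf hU) hW, h𝔞.conn_smul_left hSf hU hW,
    h𝔞.conn_smul_left hf (h𝔞.smooth_bracket hU hS) hW]
  simp only [smul_sub]
  abel

theorem curvatureOp_add_right (h𝔞 : 𝔞.IsLawful) (hU : 𝔞.IsSmooth U) (hS : 𝔞.IsSmooth S)
    (hT : 𝔞.IsSmooth T) (hW : 𝔞.IsSmooth W) :
    𝔞.curvatureOp U S (T + W) = 𝔞.curvatureOp U S T + 𝔞.curvatureOp U S W := by
  simp only [curvatureOp]
  rw [h𝔞.conn_add_right hS hT hW, h𝔞.conn_add_right hU hT hW,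
    h𝔞.conn_add_right hU (h𝔞.smooth_conn hS hT) (h𝔞.smooth_conn hS hW),
    h𝔞.conn_add_right hS (h𝔞.smooth_conn hU hT) (h𝔞.smooth_conn hU hW),
    h𝔞.conn_add_right (h𝔞.smooth_bracket hU hS) hT hW]
  abel

/-- The second derivatives of `f` cancel because the anchor is compatible with the brackets. -/
theorem curvatureOp_smul_right [T2Space M] (h𝔞 : 𝔞.IsLawful) (hU : 𝔞.IsSmooth U)
    (hS : 𝔞.IsSmooth S) (hf : ContMDiff I 𝓘(ℝ) ∞ f) (hW : 𝔞.IsSmooth W) :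
    𝔞.curvatureOp U S (f • W) = f • 𝔞.curvatureOp U S W := by
  have hSf := h𝔞.smooth_deriv hS hf
  have hUf := h𝔞.smooth_deriv hU hf
  have hUW := h𝔞.smooth_conn hU hW
  have hSW := h𝔞.smooth_conn hS hW
  simp only [curvatureOp]
  rw [h𝔞.conn_smul_right hS hf hW, h𝔞.conn_smul_right hU hf hW,
    h𝔞.conn_smul_right (h𝔞.smooth_bracket hU hS) hf hW,
    h𝔞.conn_add_right hU (h𝔞.smooth_smul hf hSW) (h𝔞.smooth_smul hSf hW),
    h𝔞.conn_add_right hS (h𝔞.smooth_smul hf hUW) (h𝔞.smooth_smul hUf hW),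
    h𝔞.conn_smul_right hU hf hSW, h𝔞.conn_smul_right hU hSf hW,
    h𝔞.conn_smul_right hS hf hUW, h𝔞.conn_smul_right hS hUf hW, h𝔞.deriv_bracket hU hS hf]
  simp only [smul_sub, sub_smul]
  abel

/-- The curvature operator is tensorial, so the trilinear map in the definition of the curvature
tensor exists. -/
theorem curvature_spec [T2Space M] (h𝔞 : 𝔞.IsLawful) (hU : 𝔞.IsSmooth U) (hS : 𝔞.IsSmooth S)
    (hW : 𝔞.IsSmooth W) (p : M) :
    𝔞.curvature p (U p) (S p) (W p) = 𝔞.curvatureOp U S W p := by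
  have hex := h𝔞.exists_linearMap₃ (p := p) (Φ := fun U S W ↦ 𝔞.curvatureOp U S W p)
    (fun S W hS hW ↦
      ⟨fun hU hT ↦ congrFun (h𝔞.curvatureOp_add_left hU hT hS hW) p,
        fun hf hU ↦ congrFun (h𝔞.curvatureOp_smul_left hf hU hS hW) p⟩)
    (fun U W hU hW ↦
      ⟨fun {S T} hS hT ↦ by
          rw [h𝔞.curvatureOp_swap hU (h𝔞.smooth_add hS hT) hW, h𝔞.curvatureOp_swap hU hS hW,
            h𝔞.curvatureOp_swap hU hT hW, h𝔞.curvatureOp_add_left hS hT hU hW]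
          simp [add_comm],
        fun {f S} hf hS ↦ by
          rw [h𝔞.curvatureOp_swap hU (h𝔞.smooth_smul hf hS) hW, h𝔞.curvatureOp_swap hU hS hW,
            h𝔞.curvatureOp_smul_left hf hS hU hW]
          simp⟩)
    (fun U S hU hS ↦
      ⟨fun hW hT ↦ congrFun (h𝔞.curvatureOp_add_right hU hS hW hT) p,
        fun hf hW ↦ congrFun (h𝔞.curvatureOp_smul_right hU hS hf hW) p⟩)
  exact Classical.epsilon_spec hex U S W hU hS hW

theorem contract_eq_sum (h𝔞 : 𝔞.IsLawful) {A : Type*} [AddCommGroup A] [Module ℝ A] {p : M}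
    {κ : Type*} [Fintype κ] {a a' : κ → V p} (ha : ∀ v, ∑ j, 𝔞.metric p v (a' j) • a j = v)
    (B : V p →ₗ[ℝ] V p →ₗ[ℝ] A) : 𝔞.contract p B = ∑ j, B (a j) (a' j) :=
  sum_eq_sum_of_represents (𝔞.metric p)
    (fun v ↦ sum_dualBasis_left (𝔞.metric p) (𝔞.nondegenerate p) _ v) (h𝔞.metric_symm p) ha B

end SRAlgebroid.IsLawful

/-! ### The tangent bundle and the tensor `F` -/

section Tangent

variable {E : Type*} [NormedAddCommGroup E] [NormedSpace ℝ E] [FiniteDimensional ℝ E]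
  {H : Type*} [TopologicalSpace H] {I : ModelWithCorners ℝ E H}
  {M : Type*} [TopologicalSpace M] [T2Space M] [ChartedSpace H M] [IsManifold I ∞ M]
  (g : SemiRiemannianMetric I M)

/-- The metric identifies smooth vector fields with smooth one-forms. -/
theorem isSmoothField_of_inner {X : Π p : M, TangentSpace I p}
    (h : ∀ Y : Π p : M, TangentSpace I p, IsSmoothField I Y →
      ContMDiff I 𝓘(ℝ) ∞ fun p ↦ g.inner p (X p) (Y p)) : IsSmoothField I X := by
  intro p
  obtain ⟨n, e, χ, he, hχ, hχp, hfr⟩ := SRAlgebroid.exists_frame (𝔞 := tangentAlgebroid g)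
    exists_isSmoothField (fun _ _ ↦ rfl) (fun hS hT ↦ contMDiff_inner g hS hT) p
  obtain ⟨c, hc, hX, -⟩ := hfr X fun i ↦ h _ (he i)
  have hsum : IsSmoothField I (χ • X) := by
    rw [hX]
    exact Finset.sum_induction _ (IsSmoothField I) (fun _ _ ↦ IsSmoothField.add)
      (Bundle.contMDiff_zeroSection ℝ (fun p : M ↦ TangentSpace I p)) fun i _ ↦ (he i).smul (hc i)
  -- Near `p` the factor `χ` is invertible, and `X` is `χ⁻¹` times the smooth field `χ • X`.
  have hinv : ContMDiffAt I 𝓘(ℝ) ∞ (fun q ↦ (χ q)⁻¹) p := (hχ p).inv₀ hχp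
  have h1 := ContMDiffAt.smul_section hinv (hsum p)
  refine h1.congr_of_eventuallyEq ?_
  have hne : ∀ᶠ q in nhds p, χ q ≠ 0 := hχ.continuous.continuousAt.eventually_ne hχp
  filter_upwards [hne] with q hq
  simp [smul_smul, inv_mul_cancel₀ hq]

theorem tangentAlgebroid_isLawful : (tangentAlgebroid g).IsLawful where
  smooth_add := IsSmoothField.add
  smooth_smul := IsSmoothField.smul
  exists_smooth := exists_isSmoothField
  finrank_eq _ _ := rfl
  metric_symm := g.symm
  smooth_pairing hS hT := contMDiff_inner g hS hT
  smooth_of_pairing := isSmoothField_of_inner g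
  smooth_anchor hS := hS
  smooth_bracket := isSmoothField_mlieBracket
  bracket_swap _ _ := VectorField.mlieBracket_swap
  bracket_add _ := mlieBracket_add
  bracket_smul hf _ hT := mlieBracket_smul hf hT
  anchor_bracket _ _ _ := rfl

variable {A : Π p : M, TangentSpace I p} {X Y Z : Π p : M, TangentSpace I p}

/-- The right-hand side is tensorial in `X` and `Y`, so the endomorphism `F` exists. -/
theorem fieldF_spec (hA : IsSmoothField I A) (hX : IsSmoothField I X) (hY : IsSmoothField I Y)
    (p : M) : g.inner p (fieldF g A p (X p)) (Y p) = 1 / 2 *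
        (g.inner p ((tangentAlgebroid g).conn X A p) (Y p)
          - g.inner p (X p) ((tangentAlgebroid g).conn Y A p)) := by
  have hl := tangentAlgebroid_isLawful g
  have hex : ∃ f : TangentSpace I p →ₗ[ℝ] TangentSpace I p,
      ∀ X Y : Π p : M, TangentSpace I p, IsSmoothField I X → IsSmoothField I Y →
      g.inner p (f (X p)) (Y p) = 1 / 2 *
        (g.inner p ((tangentAlgebroid g).conn X A p) (Y p)
          - g.inner p (X p) ((tangentAlgebroid g).conn Y A p)) := by
    obtain ⟨L, hL⟩ := hl.exists_linearMap₂ (p := p) (Φ := fun X Y ↦ 1 / 2 *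
        (g.inner p ((tangentAlgebroid g).conn X A p) (Y p)
          - g.inner p (X p) ((tangentAlgebroid g).conn Y A p)))
      (fun Y hY ↦ ⟨fun {X Z} hX hZ ↦ by
          rw [hl.conn_add_left hX hZ hA]
          simp
          ring, fun {f X} hf hX ↦ by
          rw [hl.conn_smul_left hf hX hA]
          simp
          ring⟩)
      (fun X hX ↦ ⟨fun {Y Z} hY hZ ↦ by
          rw [hl.conn_add_left hY hZ hA]
          simp
          ring, fun {f Y} hf hY ↦ by
          rw [hl.conn_smul_left hf hY hA]
          simp
          ring⟩)
    refine ⟨((g.form p).toDual (g.form_nondegenerate p)).symm.toLinearMap ∘ₗ L, fun X Y hX hY ↦ ?_⟩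
    rw [← hL X Y hX hY, ← g.form_apply]
    simp
  exact Classical.epsilon_spec hex X Y hX hY

theorem inner_fieldF (hA : IsSmoothField I A) (p : M) (x y : TangentSpace I p) :
    g.inner p (fieldF g A p x) y = - g.inner p x (fieldF g A p y) := by
  obtain ⟨X, hX, rfl⟩ := exists_isSmoothField p x
  obtain ⟨Y, hY, rfl⟩ := exists_isSmoothField p y
  rw [g.symm p (X p), fieldF_spec g hA hX hY, fieldF_spec g hA hY hX, g.symm p (X p),
    g.symm p (Y p)]
  ring

theorem isSmoothField_fieldF (hA : IsSmoothField I A) (hX : IsSmoothField I X) :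
    IsSmoothField I fun p ↦ fieldF g A p (X p) := by
  have hl := tangentAlgebroid_isLawful g
  refine isSmoothField_of_inner g fun Y hY ↦ ?_
  simp only [fieldF_spec g hA hX hY]
  exact contMDiff_const.mul ((contMDiff_inner g (hl.smooth_conn hX hA) hY).sub
    (contMDiff_inner g hX (hl.smooth_conn hY hA)))

theorem covDeriv_spec {T : Π p : M, TangentSpace I p →ₗ[ℝ] TangentSpace I p}
    (hT : ∀ X, IsSmoothField I X → IsSmoothField I fun p ↦ T p (X p))
    (hX : IsSmoothField I X) (hY : IsSmoothField I Y) (p : M) :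
    covDeriv g T p (X p) (Y p) = (tangentAlgebroid g).conn X (fun q ↦ T q (Y q)) p
        - T p ((tangentAlgebroid g).conn X Y p) := by
  have hl := tangentAlgebroid_isLawful g
  have hadd : ∀ Y Z : Π p : M, TangentSpace I p, (fun q ↦ T q ((Y + Z) q)) =
      (fun q ↦ T q (Y q)) + fun q ↦ T q (Z q) := fun Y Z ↦ by ext q; simp
  have hsmul : ∀ (f : M → ℝ) (Z : Π p : M, TangentSpace I p), (fun q ↦ T q ((f • Z) q)) =
      f • fun q ↦ T q (Z q) := fun f Z ↦ by ext q; simp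
  have hex := hl.exists_linearMap₂ (p := p)
    (Φ := fun X Y ↦ (tangentAlgebroid g).conn X (fun q ↦ T q (Y q)) p
        - T p ((tangentAlgebroid g).conn X Y p))
    (fun Y hY ↦ ⟨fun {X Z} hX hZ ↦ by
        rw [hl.conn_add_left hX hZ (hT Y hY), hl.conn_add_left hX hZ hY]
        simp
        abel, fun {f X} hf hX ↦ by
        rw [hl.conn_smul_left hf hX (hT Y hY), hl.conn_smul_left hf hX hY]
        simp [smul_sub]⟩)
    (fun X hX ↦ ⟨fun {Y Z} hY hZ ↦ by
        rw [hadd, hl.conn_add_right hX (hT Y hY) (hT Z hZ), hl.conn_add_right hX hY hZ]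
        simp
        abel, fun {f Y} hf hY ↦ by
        rw [hsmul, hl.conn_smul_right hX hf (hT Y hY), hl.conn_smul_right hX hf hY]
        simp [smul_sub]⟩)
  exact Classical.epsilon_spec hex X Y hX hY

/-- The covariant derivatives of the skew endomorphism field `F` are again skew. -/
theorem inner_covDeriv_fieldF (hA : IsSmoothField I A) (p : M) (x y z : TangentSpace I p) :
    g.inner p (covDeriv g (fieldF g A) p x y) z =
      - g.inner p y (covDeriv g (fieldF g A) p x z) := by
  have hl := tangentAlgebroid_isLawful g
  have hF := fun X hX ↦ isSmoothField_fieldF g (X := X) hA hX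
  obtain ⟨X, hX, rfl⟩ := exists_isSmoothField p x
  obtain ⟨Y, hY, rfl⟩ := exists_isSmoothField p y
  obtain ⟨Z, hZ, rfl⟩ := exists_isSmoothField p z
  rw [covDeriv_spec g hF hX hY, covDeriv_spec g hF hX hZ]
  have h1 := congrFun (hl.deriv_pairing hX (hF Y hY) hZ) p
  have h2 := congrFun (hl.deriv_pairing hX hY (hF Z hZ)) p
  have h3 : (tangentAlgebroid g).pairing (fun q ↦ fieldF g A q (Y q)) Z =
      (fun _ : M ↦ (-1 : ℝ)) * (tangentAlgebroid g).pairing Y (fun q ↦ fieldF g A q (Z q)) := by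
    ext q
    simpa [SRAlgebroid.pairing] using! inner_fieldF g hA q (Y q) (Z q)
  have h4 : (tangentAlgebroid g).deriv X
      ((tangentAlgebroid g).pairing (fun q ↦ fieldF g A q (Y q)) Z) p =
      - (tangentAlgebroid g).deriv X
        ((tangentAlgebroid g).pairing Y (fun q ↦ fieldF g A q (Z q))) p := by
    rw [h3]
    have := congrFun (SRAlgebroid.deriv_mul (𝔞 := tangentAlgebroid g) (U := X)
      (f := fun _ : M ↦ (-1 : ℝ)) contMDiff_const (hl.smooth_pairing hY (hF Z hZ))) p
    rw [SRAlgebroid.deriv_const] at this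
    refine this.trans ?_
    simp
  rw [h1, h2] at h4
  change g.inner p _ _ + g.inner p _ _ = -(g.inner p _ _ + g.inner p _ _) at h4
  simp only [map_sub, sub_apply]
  rw [inner_fieldF g hA p _ (Z p), ← g.symm p (fieldF g A p _) (Y p), inner_fieldF g hA p _ (Y p),
    g.symm p _ (fieldF g A p (Y p))]
  linarith

end Tangent

/-! ### The algebroid of affine functions -/

section HatBundle

variable {E : Type*} [NormedAddCommGroup E] [NormedSpace ℝ E] [FiniteDimensional ℝ E]
  {H : Type*} [TopologicalSpace H] {I : ModelWithCorners ℝ E H}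
  {M : Type*} [TopologicalSpace M] [T2Space M] [ChartedSpace H M] [IsManifold I ∞ M]
  (g : SemiRiemannianMetric I M) (A : Π p : M, TangentSpace I p)

theorem rho_xi (p : M) : rho g p (xi p) = 0 := by
  have h : (xi p : Hat I p).linear = 0 := rfl
  simp only [rho, LinearMap.coe_mk, AddHom.coe_mk, h, map_zero]

theorem xi_apply (p : M) (x : TangentSpace I p) : (xi p : Hat I p) x = 1 := rfl

variable {g A} in
theorem hat_ext {p : M} {s t : Hat I p} (h : rho g p s = rho g p t) (h' : s (A p) = t (A p)) :
    s = t := by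
  rw [← bar_rho_add g A p s, h, h', bar_rho_add]

theorem finrank_hat (p : M) : Module.finrank ℝ (Hat I p) = Module.finrank ℝ E + 1 := by
  have h := (AffineMap.toConstProdLinearMap (R := ℝ) (k := ℝ) (V1 := TangentSpace I p)
    (V2 := ℝ)).finrank_eq
  rw [h, Module.finrank_prod, Module.finrank_linearMap]
  simp [add_comm, show Module.finrank ℝ (TangentSpace I p) = Module.finrank ℝ E from rfl]

/-- The section `X̄ + f ξ`. -/
def hatSection (X : Π p : M, TangentSpace I p) (f : M → ℝ) : Π p : M, Hat I p :=
  fun p ↦ bar g A p (X p) + f p • xi p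

variable {X Y Z : Π p : M, TangentSpace I p} {f h : M → ℝ}

theorem rho_hatSection (X : Π p : M, TangentSpace I p) (f : M → ℝ) (p : M) :
    rho g p (hatSection g A X f p) = X p := by
  simp [hatSection, rho_bar, rho_xi]

theorem hatSection_apply (X : Π p : M, TangentSpace I p) (f : M → ℝ) (p : M) :
    hatSection g A X f p (A p) = f p := by
  simp [hatSection, bar_apply_A, xi_apply]

theorem isSmooth_hatSection (hX : IsSmoothField I X) (hf : ContMDiff I 𝓘(ℝ) ∞ f) :
    (hatAlgebroid g A).IsSmooth (hatSection g A X f) := by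
  refine ⟨?_, ?_⟩
  · simpa only [rho_hatSection] using hX
  · simpa only [hatSection_apply] using hf

theorem rho_hatBracket (S T : Π p : M, Hat I p) (p : M) :
    rho g p (hatBracket g A S T p) =
      VectorField.mlieBracket I (fun q ↦ rho g q (S q)) (fun q ↦ rho g q (T q)) p := by
  simp [hatBracket, rho_bar, rho_xi]

theorem hatBracket_apply (S T : Π p : M, Hat I p) (p : M) :
    hatBracket g A S T p (A p) = mvfderiv I (fun q ↦ T q (A q)) p (rho g p (S p))
      - mvfderiv I (fun q ↦ S q (A q)) p (rho g p (T p))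
      + 2 * g.inner p (fieldF g A p (rho g p (S p))) (rho g p (T p)) := by
  simp [hatBracket, bar_apply_A, xi_apply]

theorem hatAlgebroid_isLawful (hA : IsSmoothField I A) : (hatAlgebroid g A).IsLawful where
  smooth_add := by
    rintro S T ⟨hS, hS'⟩ ⟨hT, hT'⟩
    refine ⟨?_, hS'.add hT'⟩
    simp only [Pi.add_apply, map_add]
    exact hS.add hT
  smooth_smul := by
    rintro f S hf ⟨hS, hS'⟩
    refine ⟨?_, hf.mul hS'⟩
    simp only [Pi.smul_apply', map_smul]
    exact hS.smul hf
  exists_smooth p s := by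
    obtain ⟨X, hX, hXp⟩ := exists_isSmoothField p (rho g p s)
    refine ⟨hatSection g A X fun _ ↦ s (A p), isSmooth_hatSection g A hX contMDiff_const, ?_⟩
    simp only [hatSection, hXp]
    exact bar_rho_add ..
  finrank_eq p q := by rw [finrank_hat, finrank_hat]
  metric_symm p s t := by
    change hatForm g A p s t = hatForm g A p t s
    rw [hatForm_apply, hatForm_apply, g.symm, mul_comm]
  smooth_pairing := by
    rintro S T ⟨hS, hS'⟩ ⟨hT, hT'⟩
    exact (contMDiff_inner g hS hT).add (hS'.mul hT')
  smooth_of_pairing := by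
    intro S hS
    refine ⟨isSmoothField_of_inner g fun Y hY ↦ ?_, ?_⟩
    · refine (hS _ (isSmooth_hatSection g A (f := fun _ ↦ 0) hY contMDiff_const)).congr fun p ↦ ?_
      change _ = hatForm g A p _ _
      simp [hatForm_apply, rho_hatSection, hatSection_apply]
    · refine (hS _ (isSmooth_hatSection g A (X := 0) (f := fun _ ↦ 1)
        (tangentAlgebroid_isLawful g).smooth_zero contMDiff_const)).congr fun p ↦ ?_
      change _ = hatForm g A p _ _
      simp [hatForm_apply, rho_hatSection, hatSection_apply]
  smooth_anchor hS := hS.1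
  smooth_bracket := by
    rintro S T ⟨hS, hS'⟩ ⟨hT, hT'⟩
    change IsSmoothField I (fun q ↦ rho g q (hatBracket g A S T q)) ∧
      ContMDiff I 𝓘(ℝ) ∞ (fun q ↦ hatBracket g A S T q (A q))
    simp only [rho_hatBracket, hatBracket_apply]
    exact ⟨isSmoothField_mlieBracket hS hT, ((contMDiff_mvfderiv hT' hS).sub
      (contMDiff_mvfderiv hS' hT)).add
      (contMDiff_const.mul (contMDiff_inner g (isSmoothField_fieldF g hA hS) hT))⟩
  bracket_swap := by
    rintro S T - -
    change hatBracket g A S T = - hatBracket g A T S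
    ext1 p
    refine hat_ext (g := g) (A := A) ?_ ?_
    · rw [Pi.neg_apply, map_neg, rho_hatBracket, rho_hatBracket, VectorField.mlieBracket_swap_apply]
    · rw [Pi.neg_apply, AffineMap.coe_neg, Pi.neg_apply, hatBracket_apply, hatBracket_apply,
        inner_fieldF g hA, g.symm p (rho g p (S p))]
      ring
  bracket_add := by
    rintro U S T ⟨hU, hU'⟩ ⟨hS, hS'⟩ ⟨hT, hT'⟩
    change hatBracket g A U (S + T) = hatBracket g A U S + hatBracket g A U T
    ext1 p
    refine hat_ext (g := g) (A := A) ?_ ?_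
    · simp only [Pi.add_apply, map_add, rho_hatBracket]
      exact congrFun (mlieBracket_add hS hT) p
    · simp only [Pi.add_apply, AffineMap.coe_add, hatBracket_apply, map_add]
      rw [mvfderiv_fun_add ((hS' p).mdifferentiableAt (by simp))
        ((hT' p).mdifferentiableAt (by simp))]
      simp only [add_apply]
      ring
  bracket_smul := by
    rintro f S T hf ⟨hS, hS'⟩ ⟨hT, hT'⟩
    change hatBracket g A S (f • T) =
      f • hatBracket g A S T + (fun p ↦ mvfderiv I f p (rho g p (S p))) • T
    ext1 p
    refine hat_ext (g := g) (A := A) ?_ ?_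
    · simp only [Pi.add_apply, Pi.smul_apply', map_add, map_smul, rho_hatBracket]
      exact congrFun (mlieBracket_smul hf hT) p
    · simp only [Pi.add_apply, Pi.smul_apply', AffineMap.coe_add, Pi.add_apply, AffineMap.coe_smul, Pi.smul_apply,
        hatBracket_apply, map_smul, smul_eq_mul]
      rw [mvfderiv_fun_mul ((hf p).mdifferentiableAt (by simp))
        ((hT' p).mdifferentiableAt (by simp))]
      simp only [add_apply, smul_apply, smul_eq_mul]
      ring
  anchor_bracket p _ _ := rho_hatBracket g A _ _ p

end HatBundle

/-! ### Connection and curvature of the algebroid of affine functions -/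

section HatConnection

variable {E : Type*} [NormedAddCommGroup E] [NormedSpace ℝ E] [FiniteDimensional ℝ E]
  {H : Type*} [TopologicalSpace H] {I : ModelWithCorners ℝ E H}
  {M : Type*} [TopologicalSpace M] [T2Space M] [ChartedSpace H M] [IsManifold I ∞ M]
  (g : SemiRiemannianMetric I M) (A : Π p : M, TangentSpace I p)
  {X Y Z : Π p : M, TangentSpace I p} {f h : M → ℝ}

/-- The vector field `F X`. -/
def applyF (X : Π p : M, TangentSpace I p) : Π p : M, TangentSpace I p :=
  fun p ↦ fieldF g A p (X p)

theorem applyF_zero : applyF g A (0 : Π p : M, TangentSpace I p) = 0 := by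
  ext p; simp [applyF]

theorem hatSection_zero_right (X : Π p : M, TangentSpace I p) (p : M) :
    hatSection g A X 0 p = bar g A p (X p) := by
  simp [hatSection]

theorem hatSection_zero_one (p : M) : hatSection g A 0 1 p = xi p := by
  simp [hatSection]

theorem bracket_hatSection (X Y : Π p : M, TangentSpace I p) (f h : M → ℝ) :
    (hatAlgebroid g A).bracket (hatSection g A X f) (hatSection g A Y h) =
      hatSection g A (VectorField.mlieBracket I X Y)
        ((tangentAlgebroid g).deriv X h - (tangentAlgebroid g).deriv Y f
          + 2 * (tangentAlgebroid g).pairing (applyF g A X) Y) := by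
  ext1 p
  change hatBracket g A _ _ p = _
  refine hat_ext (g := g) (A := A) ?_ ?_
  · simp only [rho_hatBracket, rho_hatSection]
  · simp only [hatBracket_apply, rho_hatSection, hatSection_apply]
    rfl

theorem pairing_hatSection (X Y : Π p : M, TangentSpace I p) (f h : M → ℝ) :
    (hatAlgebroid g A).pairing (hatSection g A X f) (hatSection g A Y h) =
      (tangentAlgebroid g).pairing X Y + f * h := by
  ext1 p
  change hatForm g A p _ _ = _
  rw [hatForm_apply, rho_hatSection, rho_hatSection, hatSection_apply, hatSection_apply]
  rfl

theorem deriv_hatSection (X : Π p : M, TangentSpace I p) (f h : M → ℝ) :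
    (hatAlgebroid g A).deriv (hatSection g A X f) h = (tangentAlgebroid g).deriv X h := by
  ext1 p
  change mvfderiv I h p (rho g p _) = _
  rw [rho_hatSection]
  rfl

/-- The Levi-Civita connection of the algebroid of affine functions in terms of `∇` and `F`. -/
theorem conn_hatSection (hA : IsSmoothField I A) (hX : IsSmoothField I X)
    (hf : ContMDiff I 𝓘(ℝ) ∞ f) (hY : IsSmoothField I Y) (hh : ContMDiff I 𝓘(ℝ) ∞ h) :
    (hatAlgebroid g A).conn (hatSection g A X f) (hatSection g A Y h) =
      hatSection g A
        ((tangentAlgebroid g).conn X Y - h • applyF g A X - f • applyF g A Y)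
        ((tangentAlgebroid g).pairing (applyF g A X) Y + (tangentAlgebroid g).deriv X h) := by
  have hl := tangentAlgebroid_isLawful g
  have hL := hatAlgebroid_isLawful g A hA
  ext1 p
  refine hL.eq_of_metric fun W hW ↦ ?_
  obtain ⟨Z, k, hZ, hk, rfl⟩ : ∃ Z k, IsSmoothField I Z ∧ ContMDiff I 𝓘(ℝ) ∞ k ∧
      W = hatSection g A Z k :=
    ⟨_, _, hW.1, hW.2, funext fun p ↦ (bar_rho_add g A p (W p)).symm⟩
  rw [hL.pairing_conn (isSmooth_hatSection g A hX hf) (isSmooth_hatSection g A hY hh) hW]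
  change _ = (hatAlgebroid g A).pairing (hatSection g A _ _) (hatSection g A Z k) p
  have e1 := hl.pairing_conn hX hY hZ p
  have e2 : (tangentAlgebroid g).pairing (applyF g A Z) X p =
      - (tangentAlgebroid g).pairing (applyF g A X) Z p := by
    rw [hl.pairing_comm (applyF g A X) Z]
    exact inner_fieldF g hA p (Z p) (X p)
  have e3 : ∀ Y Z, (tangentAlgebroid g).pairing (-Y) Z = - (tangentAlgebroid g).pairing Y Z :=
    SRAlgebroid.pairing_neg_left
  change (tangentAlgebroid g).pairing _ _ p = _ at e1
  simp only [SRAlgebroid.koszul, bracket_hatSection, pairing_hatSection, deriv_hatSection,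
    SRAlgebroid.deriv_add (hl.smooth_pairing hY hZ) (hh.mul hk),
    SRAlgebroid.deriv_add (hl.smooth_pairing hZ hX) (hk.mul hf),
    SRAlgebroid.deriv_add (hl.smooth_pairing hX hY) (hf.mul hh),
    SRAlgebroid.deriv_mul hh hk, SRAlgebroid.deriv_mul hk hf, SRAlgebroid.deriv_mul hf hh,
    sub_eq_add_neg, SRAlgebroid.pairing_add_left, e3, SRAlgebroid.pairing_smul_left,
    Pi.add_apply, Pi.mul_apply, Pi.neg_apply, Pi.ofNat_apply] at e1 ⊢
  rw [e1, e2]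
  have hbr : ∀ X Y : Π p : M, TangentSpace I p,
    (tangentAlgebroid g).bracket X Y = VectorField.mlieBracket I X Y := fun _ _ ↦ rfl
  simp only [hbr]
  ring

variable {g A} in
theorem hatSection_congr {X Y : Π p : M, TangentSpace I p} {f h : M → ℝ} (hX : X = Y)
    (hf : f = h) : hatSection g A X f = hatSection g A Y h := by
  rw [hX, hf]

theorem conn_bar (hA : IsSmoothField I A) (hX : IsSmoothField I X) (hY : IsSmoothField I Y)
    (hh : ContMDiff I 𝓘(ℝ) ∞ h) :
    (hatAlgebroid g A).conn (hatSection g A X 0) (hatSection g A Y h) =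
      hatSection g A ((tangentAlgebroid g).conn X Y - h • applyF g A X)
        ((tangentAlgebroid g).pairing (applyF g A X) Y + (tangentAlgebroid g).deriv X h) := by
  rw [conn_hatSection g A hA hX contMDiff_zero hY hh]
  refine hatSection_congr ?_ rfl
  ext p
  simp

theorem conn_xi (hA : IsSmoothField I A) (hY : IsSmoothField I Y) (hh : ContMDiff I 𝓘(ℝ) ∞ h) :
    (hatAlgebroid g A).conn (hatSection g A 0 1) (hatSection g A Y h) =
      hatSection g A (-applyF g A Y) 0 := by
  have hl := tangentAlgebroid_isLawful g
  rw [conn_hatSection g A hA hl.smooth_zero contMDiff_one hY hh, hl.conn_zero_left hY,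
    applyF_zero]
  refine hatSection_congr ?_ ?_
  · ext p
    simp
  · ext p
    simp [SRAlgebroid.pairing, SRAlgebroid.deriv]

theorem conn_bar_bar (hA : IsSmoothField I A) (hX : IsSmoothField I X) (hY : IsSmoothField I Y) :
    (hatAlgebroid g A).conn (hatSection g A X 0) (hatSection g A Y 0) =
      hatSection g A ((tangentAlgebroid g).conn X Y)
        ((tangentAlgebroid g).pairing (applyF g A X) Y) := by
  rw [conn_bar g A hA hX hY contMDiff_zero]
  refine hatSection_congr ?_ ?_
  · ext p
    simp
  · ext p
    simp [SRAlgebroid.deriv]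

theorem conn_bar_xi (hA : IsSmoothField I A) (hX : IsSmoothField I X) :
    (hatAlgebroid g A).conn (hatSection g A X 0) (hatSection g A 0 1) =
      hatSection g A (-applyF g A X) 0 := by
  have hl := tangentAlgebroid_isLawful g
  rw [conn_bar g A hA hX hl.smooth_zero contMDiff_one, hl.conn_zero_right hX]
  refine hatSection_congr ?_ ?_
  · ext p
    simp
  · rw [show (1 : M → ℝ) = fun _ ↦ 1 from rfl, SRAlgebroid.deriv_const]
    ext p
    simp [SRAlgebroid.pairing]

theorem bracket_xi_bar (X : Π p : M, TangentSpace I p) :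
    (hatAlgebroid g A).bracket (hatSection g A 0 1) (hatSection g A X 0) = 0 := by
  rw [bracket_hatSection, applyF_zero, VectorField.mlieBracket_zero_left,
    show (1 : M → ℝ) = fun _ ↦ 1 from rfl, SRAlgebroid.deriv_const]
  ext1 p
  simp [hatSection, SRAlgebroid.pairing, SRAlgebroid.deriv]

theorem curvature_xi_xi (hA : IsSmoothField I A) (p : M) (s : Hat I p) :
    (hatAlgebroid g A).curvature p (xi p) (xi p) s = 0 := by
  have hL := hatAlgebroid_isLawful g A hA
  obtain ⟨S, hS, rfl⟩ := hL.exists_smooth p s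
  obtain ⟨U, hU, hUp⟩ := hL.exists_smooth p (xi p)
  rw [← hUp, hL.curvature_spec hU hU hS]
  have h := congrFun (hL.curvatureOp_swap hU hU hS) p
  rw [Pi.neg_apply, eq_neg_iff_add_eq_zero, ← two_smul ℝ] at h
  exact (smul_eq_zero.1 h).resolve_left two_ne_zero

theorem curvature_xi_bar_bar (hA : IsSmoothField I A) (p : M) (x y : TangentSpace I p) :
    (hatAlgebroid g A).curvature p (xi p) (bar g A p x) (bar g A p y) =
      bar g A p (covDeriv g (fieldF g A) p x y)
        + g.inner p (fieldF g A p x) (fieldF g A p y) • xi p := by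
  have hl := tangentAlgebroid_isLawful g
  have hL := hatAlgebroid_isLawful g A hA
  have hF : ∀ X, IsSmoothField I X → IsSmoothField I (applyF g A X) :=
    fun X hX ↦ isSmoothField_fieldF g hA hX
  obtain ⟨X, hX, rfl⟩ := exists_isSmoothField p x
  obtain ⟨Y, hY, rfl⟩ := exists_isSmoothField p y
  rw [← hatSection_zero_right, ← hatSection_zero_right, ← hatSection_zero_one g A,
    hL.curvature_spec (isSmooth_hatSection g A hl.smooth_zero contMDiff_one)
      (isSmooth_hatSection g A hX contMDiff_zero) (isSmooth_hatSection g A hY contMDiff_zero),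
    SRAlgebroid.curvatureOp, conn_bar_bar g A hA hX hY,
    conn_xi g A hA (hl.smooth_conn hX hY) (hl.smooth_pairing (hF X hX) hY),
    conn_xi g A hA hY contMDiff_zero, conn_bar_bar g A hA hX (hl.smooth_neg (hF Y hY)),
    bracket_xi_bar, hL.conn_zero_left (isSmooth_hatSection g A hY contMDiff_zero),
    covDeriv_spec g hF hX hY, hl.conn_neg_right hX (hF Y hY)]
  refine hat_ext (g := g) (A := A) ?_ ?_
  · simp [rho_hatSection, rho_bar]
    rw [neg_add_eq_sub]
    rfl
  · simp [hatSection_apply, bar_apply_A, SRAlgebroid.pairing]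
    rfl

theorem curvature_bar_xi_xi (hA : IsSmoothField I A) (p : M) (x : TangentSpace I p) :
    (hatAlgebroid g A).curvature p (bar g A p x) (xi p) (xi p) =
      - bar g A p (fieldF g A p (fieldF g A p x)) := by
  have hl := tangentAlgebroid_isLawful g
  have hL := hatAlgebroid_isLawful g A hA
  have hξ := isSmooth_hatSection g A hl.smooth_zero contMDiff_one
  have hF : ∀ X, IsSmoothField I X → IsSmoothField I (applyF g A X) :=
    fun X hX ↦ isSmoothField_fieldF g hA hX
  obtain ⟨X, hX, rfl⟩ := exists_isSmoothField p x
  have hXs := isSmooth_hatSection g A hX contMDiff_zero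
  have hxx : (hatAlgebroid g A).conn (hatSection g A 0 1) (hatSection g A 0 1) = 0 := by
    rw [conn_xi g A hA hl.smooth_zero contMDiff_one, applyF_zero]
    ext1 p
    simp [hatSection]
  rw [← hatSection_zero_right, ← hatSection_zero_one g A, hL.curvature_spec hXs hξ hξ,
    SRAlgebroid.curvatureOp, hxx, hL.conn_zero_right hXs, conn_bar_xi g A hA hX,
    conn_xi g A hA (hl.smooth_neg (hF X hX)) contMDiff_zero, hL.bracket_swap hXs hξ,
    bracket_xi_bar, neg_zero, hL.conn_zero_left hξ]
  simp [hatSection, applyF]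

theorem curvature_bar_bar_bar (hA : IsSmoothField I A) (p : M) (x y z : TangentSpace I p) :
    (hatAlgebroid g A).curvature p (bar g A p x) (bar g A p y) (bar g A p z) =
      bar g A p ((tangentAlgebroid g).curvature p x y z
          - g.inner p (fieldF g A p y) z • fieldF g A p x
          + g.inner p (fieldF g A p x) z • fieldF g A p y
          + (2 * g.inner p (fieldF g A p x) y) • fieldF g A p z)
        + g.inner p (covDeriv g (fieldF g A) p x y - covDeriv g (fieldF g A) p y x) z • xi p := by
  have hl := tangentAlgebroid_isLawful g
  have hL := hatAlgebroid_isLawful g A hA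
  have hF : ∀ X, IsSmoothField I X → IsSmoothField I (applyF g A X) :=
    fun X hX ↦ isSmoothField_fieldF g hA hX
  obtain ⟨X, hX, rfl⟩ := exists_isSmoothField p x
  obtain ⟨Y, hY, rfl⟩ := exists_isSmoothField p y
  obtain ⟨Z, hZ, rfl⟩ := exists_isSmoothField p z
  have hb : ∀ {W}, IsSmoothField I W → (hatAlgebroid g A).IsSmooth (hatSection g A W 0) :=
    fun hW ↦ isSmooth_hatSection g A hW contMDiff_zero
  have hbr : (hatAlgebroid g A).bracket (hatSection g A X 0) (hatSection g A Y 0) =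
      hatSection g A ((tangentAlgebroid g).bracket X Y)
        (2 * (tangentAlgebroid g).pairing (applyF g A X) Y) := by
    rw [bracket_hatSection]
    refine hatSection_congr rfl ?_
    ext p
    simp [SRAlgebroid.deriv]
  have h2 : ContMDiff I 𝓘(ℝ) ∞ (2 * (tangentAlgebroid g).pairing (applyF g A X) Y) :=
    (contMDiff_const (c := (2 : ℝ))).mul (hl.smooth_pairing (hF X hX) hY)
  have hR : (tangentAlgebroid g).curvature p (X p) (Y p) (Z p) = _ := hl.curvature_spec hX hY hZ p
  have ht := congrFun (hl.conn_torsion hX hY) p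
  have hFt : fieldF g A p ((tangentAlgebroid g).bracket X Y p) =
    fieldF g A p ((tangentAlgebroid g).conn X Y p)
      - fieldF g A p ((tangentAlgebroid g).conn Y X p) := by
    rw [ht]
    simp
  have hp : ∀ S T : Π q : M, TangentSpace I q,
    (tangentAlgebroid g).pairing S T p = g.inner p (S p) (T p) := fun _ _ ↦ rfl
  have hXYZ := congrFun (hl.deriv_pairing hX (hF Y hY) hZ) p
  have hYXZ := congrFun (hl.deriv_pairing hY (hF X hX) hZ) p
  rw [← hatSection_zero_right, ← hatSection_zero_right, ← hatSection_zero_right,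
    hL.curvature_spec (hb hX) (hb hY) (hb hZ), hR,
    SRAlgebroid.curvatureOp, SRAlgebroid.curvatureOp, conn_bar_bar g A hA hX hZ,
    conn_bar_bar g A hA hY hZ,
    conn_bar g A hA hX (hl.smooth_conn hY hZ) (hl.smooth_pairing (hF Y hY) hZ),
    conn_bar g A hA hY (hl.smooth_conn hX hZ) (hl.smooth_pairing (hF X hX) hZ), hbr,
    conn_hatSection g A hA (hl.smooth_bracket hX hY) h2 hZ contMDiff_zero,
    covDeriv_spec g hF hX hY, covDeriv_spec g hF hY hX]
  refine hat_ext (g := g) (A := A) ?_ ?_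
  · simp [rho_hatSection, rho_bar, rho_xi]
    simp only [hp, applyF]
    abel
  · simp [hatSection_apply, bar_apply_A, xi_apply]
    have h0 : (tangentAlgebroid g).deriv ((tangentAlgebroid g).bracket X Y) 0 p = 0 := by
      simp [SRAlgebroid.deriv]
    rw [h0, hXYZ, hYXZ]
    have hlam : ∀ W : Π q : M, TangentSpace I q, (fun q ↦ fieldF g A q (W q)) = applyF g A W :=
      fun _ ↦ rfl
    simp only [Pi.add_apply, hp, hlam, applyF, hFt, map_sub, sub_apply]
    ring

end HatConnection

/-! ### Ricci and scalar curvature -/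

section Ricci

variable {E : Type*} [NormedAddCommGroup E] [NormedSpace ℝ E] [FiniteDimensional ℝ E]
  {H : Type*} [TopologicalSpace H] {I : ModelWithCorners ℝ E H}
  {M : Type*} [TopologicalSpace M] [T2Space M] [ChartedSpace H M] [IsManifold I ∞ M]
  (g : SemiRiemannianMetric I M) {A : Π p : M, TangentSpace I p}

/-- A pair of families representing the identity of `T_pM`, completed by `ξ`, represents the
identity of the fibre of affine functions. -/
theorem hat_represents (A : Π p : M, TangentSpace I p) {p : M} {ι : Type*} [Fintype ι]
    {e e' : ι → TangentSpace I p} (he : ∀ v, ∑ i, g.form p v (e' i) • e i = v) (s : Hat I p) :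
    ∑ j : Option ι, (hatAlgebroid g A).metric p s (j.elim (xi p) fun i ↦ bar g A p (e' i)) •
      (j.elim (xi p) fun i ↦ bar g A p (e i)) = s := by
  rw [Fintype.sum_option]
  simp only [Option.elim]
  change hatForm g A p _ _ • _ + ∑ i, hatForm g A p _ _ • _ = s
  simp only [hatForm_apply, rho_xi, rho_bar, bar_apply_A, xi_apply, map_zero, zero_add, mul_one,
    mul_zero, add_zero, ← map_smul, ← map_sum]
  rw [show ∑ i, g.inner p (rho g p s) (e' i) • e i = rho g p s from he _, add_comm]
  exact bar_rho_add ..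

theorem contract_hat (hA : IsSmoothField I A) {W : Type*} [AddCommGroup W] [Module ℝ W] {p : M}
    {ι : Type*} [Fintype ι] {e e' : ι → TangentSpace I p}
    (he : ∀ v, ∑ i, g.form p v (e' i) • e i = v) (B : Hat I p →ₗ[ℝ] Hat I p →ₗ[ℝ] W) :
    (hatAlgebroid g A).contract p B =
      B (xi p) (xi p) + ∑ i, B (bar g A p (e i)) (bar g A p (e' i)) := by
  rw [(hatAlgebroid_isLawful g A hA).contract_eq_sum (hat_represents g A he), Fintype.sum_option]
  rfl

theorem trace_hat {p : M} (T : Hat I p →ₗ[ℝ] Hat I p) :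
    LinearMap.trace ℝ (Hat I p) T =
      LinearMap.trace ℝ (TangentSpace I p) (rho g p ∘ₗ T ∘ₗ bar g A p) + T (xi p) (A p) := by
  have he := sum_dualBasis_right (g.form p) (g.form_nondegenerate p) (g.symm p)
    (Module.finBasis ℝ (TangentSpace I p))
  rw [trace_eq_sum_of_represents _ (hat_represents g A he), Fintype.sum_option,
    trace_eq_sum_of_represents _ he, add_comm]
  simp only [Option.elim]
  change ∑ i, hatForm g A p _ _ + hatForm g A p _ _ = _
  simp [hatForm_apply, rho_xi, rho_bar, bar_apply_A, xi_apply, g.form_apply]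

/-- A skew endomorphism has vanishing trace. -/
theorem sum_inner_skew {p : M} {ι : Type*} [Fintype ι] {e e' : ι → TangentSpace I p}
    (he : ∀ v, ∑ i, g.form p v (e' i) • e i = v) (he' : ∀ v, ∑ i, g.form p v (e i) • e' i = v)
    {T : TangentSpace I p →ₗ[ℝ] TangentSpace I p}
    (hT : ∀ x y, g.inner p (T x) y = - g.inner p x (T y)) :
    ∑ i, g.inner p (T (e i)) (e' i) = 0 := by
  have h1 := trace_eq_sum_of_represents (g.form p) he T
  have h2 := trace_eq_sum_of_represents (g.form p) he' T
  have h3 : ∑ i, g.form p (T (e' i)) (e i) = - ∑ i, g.form p (T (e i)) (e' i) := by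
    rw [← Finset.sum_neg_distrib]
    refine Finset.sum_congr rfl fun i _ ↦ ?_
    rw [g.form_apply, g.form_apply, hT, g.symm]
  change ∑ i, g.form p (T (e i)) (e' i) = 0
  linarith

theorem ricci_xi (hA : IsSmoothField I A) (p : M) :
    (hatAlgebroid g A).ricci p (xi p) =
      bar g A p (divergence g (fieldF g A) p) - traceFF g A p • xi p := by
  set b := Module.finBasis ℝ (TangentSpace I p)
  set b' := (g.form p).dualBasis (g.form_nondegenerate p) b
  have he := sum_dualBasis_right (g.form p) (g.form_nondegenerate p) (g.symm p) b
  have htr : traceFF g A p = - ∑ i, g.inner p (fieldF g A p (b i)) (fieldF g A p (b' i)) := by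
    rw [traceFF, trace_eq_sum_of_represents _ he, ← Finset.sum_neg_distrib]
    exact Finset.sum_congr rfl fun i _ ↦ inner_fieldF g hA p _ _
  change (hatAlgebroid g A).contract p _ = _
  rw [contract_hat g hA he, curvature_xi_xi g A hA, zero_add]
  simp only [curvature_xi_bar_bar g A hA, Finset.sum_add_distrib, ← map_sum, ← Finset.sum_smul]
  rw [htr, neg_smul, sub_neg_eq_add]
  rfl

theorem ricci_bar (hA : IsSmoothField I A) (p : M) (x : TangentSpace I p) :
    (hatAlgebroid g A).ricci p (bar g A p x) =
      bar g A p ((tangentAlgebroid g).ricci p x)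
        + (2 : ℝ) • bar g A p (fieldF g A p (fieldF g A p x))
        + g.inner p (divergence g (fieldF g A) p) x • xi p := by
  set b := Module.finBasis ℝ (TangentSpace I p)
  set b' := (g.form p).dualBasis (g.form_nondegenerate p) b
  have he : ∀ v, ∑ i, g.form p v (b' i) • b i = v :=
    sum_dualBasis_right (g.form p) (g.form_nondegenerate p) (g.symm p) b
  have he' : ∀ v, ∑ i, g.form p v (b i) • b' i = v :=
    sum_dualBasis_left (g.form p) (g.form_nondegenerate p) b
  have hF0 : ∑ i, g.inner p (fieldF g A p (b i)) (b' i) = 0 :=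
    sum_inner_skew g he he' (inner_fieldF g hA p)
  have hD0 : ∑ i, g.inner p (covDeriv g (fieldF g A) p x (b i)) (b' i) = 0 :=
    sum_inner_skew g he he' (inner_covDeriv_fieldF g hA p x)
  have hdiv : ∑ i, g.inner p (covDeriv g (fieldF g A) p (b i) x) (b' i) =
      - g.inner p (divergence g (fieldF g A) p) x := by
    have : divergence g (fieldF g A) p = ∑ i, covDeriv g (fieldF g A) p (b i) (b' i) := rfl
    rw [this, map_sum, sum_apply, ← Finset.sum_neg_distrib]
    refine Finset.sum_congr rfl fun i _ ↦ ?_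
    rw [inner_covDeriv_fieldF g hA p, g.symm]
  have hFF : ∑ i, g.inner p (fieldF g A p x) (b' i) • fieldF g A p (b i) =
      fieldF g A p (fieldF g A p x) := by
    simp only [← map_smul, ← map_sum]
    exact congrArg _ (he _)
  have hFF' : ∑ i, (2 * g.inner p (fieldF g A p x) (b i)) • fieldF g A p (b' i) =
      (2 : ℝ) • fieldF g A p (fieldF g A p x) := by
    conv_rhs => rw [← he' (fieldF g A p x)]
    simp [Finset.smul_sum, mul_smul, g.form_apply]
  have hR : ∑ i, (tangentAlgebroid g).curvature p x (b i) (b' i) =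
    (tangentAlgebroid g).ricci p x := rfl
  change (hatAlgebroid g A).contract p _ = _
  rw [contract_hat g hA he, curvature_bar_xi_xi g A hA]
  simp only [curvature_bar_bar_bar g A hA, Finset.sum_add_distrib, Finset.sum_sub_distrib,
    ← map_sum, ← Finset.sum_smul, map_sub, sub_apply, hF0, hD0, hdiv, hFF, hFF', hR]
  refine hat_ext (g := g) (A := A) ?_ ?_
  · simp [rho_bar, rho_xi]
    module
  · simp [bar_apply_A, xi_apply]

theorem scalar_hat (hA : IsSmoothField I A) (p : M) :
    (hatAlgebroid g A).scalar p = (tangentAlgebroid g).scalar p + traceFF g A p := by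
  have hT : rho g p ∘ₗ (hatAlgebroid g A).ricci p ∘ₗ bar g A p =
      (tangentAlgebroid g).ricci p + (2 : ℝ) • (fieldF g A p ∘ₗ fieldF g A p) := by
    ext x
    simp [ricci_bar g hA, rho_bar, rho_xi]
  rw [SRAlgebroid.scalar, trace_hat g, hT, ricci_xi g hA, map_add, map_smul]
  simp [bar_apply_A, xi_apply, SRAlgebroid.scalar, traceFF]
  ring

end Ricci

end AffineAlgebroid

end

theorem proposition3p7
    {E : Type*} [NormedAddCommGroup E] [NormedSpace ℝ E] [FiniteDimensional ℝ E]
    {H : Type*} [TopologicalSpace H] (I : ModelWithCorners ℝ E H) [I.Boundaryless]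
    {M : Type*} [TopologicalSpace M] [T2Space M] [ChartedSpace H M] [IsManifold I ∞ M]
    (g : SemiRiemannianMetric I M) (A : Π p : M, TangentSpace I p) (hA : IsSmoothField I A) :
    (∀ p : M, (hatAlgebroid g A).ricci p (xi p) =
      bar g A p (divergence g (fieldF g A) p) - traceFF g A p • xi p) ∧
    (∀ (p : M) (x : TangentSpace I p), (hatAlgebroid g A).ricci p (bar g A p x) =
      bar g A p ((tangentAlgebroid g).ricci p x)
        + (2 : ℝ) • bar g A p (fieldF g A p (fieldF g A p x))
        + g.inner p (divergence g (fieldF g A) p) x • xi p) ∧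
    (∀ p : M, (hatAlgebroid g A).scalar p = (tangentAlgebroid g).scalar p + traceFF g A p) ∧
    (∀ (p : M) (x y : TangentSpace I p),
      (hatAlgebroid g A).einstein p (bar g A p x) (bar g A p y) =
          g.inner p ((tangentAlgebroid g).ricci p x
            + (2 : ℝ) • fieldF g A p (fieldF g A p x)) y
          - 1 / 2 * ((tangentAlgebroid g).scalar p + traceFF g A p) * g.inner p x y ∧
      (hatAlgebroid g A).einstein p (bar g A p x) (bar g A p y) =
          (tangentAlgebroid g).einstein p x y - 8 * Real.pi * stressElec g A p x y ∧
      (hatAlgebroid g A).einstein p (bar g A p x) (xi p) =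
          g.inner p (divergence g (fieldF g A) p) x ∧
      (hatAlgebroid g A).einstein p (xi p) (bar g A p x) =
          g.inner p (divergence g (fieldF g A) p) x ∧
      (hatAlgebroid g A).einstein p (xi p) (xi p) =
          -(1 / 2) * ((tangentAlgebroid g).scalar p + 3 * traceFF g A p)) := by
  have hξ : ∀ p : M, (xi p : Hat I p) (A p) = 1 := fun _ ↦ rfl
  have hρ : ∀ p : M, rho g p (xi p) = 0 := rho_xi g
  have hm : ∀ (p : M) (s t : Hat I p), (hatAlgebroid g A).metric p s t =
    g.inner p (rho g p s) (rho g p t) + s (A p) * t (A p) := fun _ _ _ ↦ rfl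
  have h1 : ∀ (p : M) (x y : TangentSpace I p),
      (hatAlgebroid g A).einstein p (bar g A p x) (bar g A p y) =
          g.inner p ((tangentAlgebroid g).ricci p x
            + (2 : ℝ) • fieldF g A p (fieldF g A p x)) y
          - 1 / 2 * ((tangentAlgebroid g).scalar p + traceFF g A p) * g.inner p x y := by
    intro p x y
    simp [SRAlgebroid.einstein, hm, ricci_bar g hA, scalar_hat g hA, rho_bar, bar_apply_A, hρ]
  refine ⟨ricci_xi g hA, ricci_bar g hA, scalar_hat g hA, fun p x y ↦ ⟨h1 p x y, ?_, ?_, ?_, ?_⟩⟩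
  · have ht : (tangentAlgebroid g).metric p = g.form p := rfl
    rw [h1, SRAlgebroid.einstein, stressElec, ht, g.form_apply, g.form_apply]
    have := Real.pi_ne_zero
    simp only [map_add, map_smul, add_apply, smul_apply, smul_eq_mul]
    field_simp
    ring
  · simp [SRAlgebroid.einstein, hm, ricci_bar g hA, rho_bar, bar_apply_A, hρ, hξ]
  · simp [SRAlgebroid.einstein, hm, ricci_xi g hA, rho_bar, bar_apply_A, hρ]
  · simp [SRAlgebroid.einstein, hm, ricci_xi g hA, scalar_hat g hA, rho_bar, bar_apply_A, hρ, hξ]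
    ring
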